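/- **Conventions.** A graph on a topological space $X$ is a symmetric irreflexive relation $G\subseteq X^2$. Write $(X,G)\preceq^i_c(Y,H)$ if there is an injective continuous map $\varphi:X\to Y$ with $(\varphi(x),\varphi(y))\in H$ whenever $(x,y)\in G$. The continuous chromatic number (CCN) of $(X,G)$ is the least cardinal $\kappa\le\aleph_0$ for which there is a continuous map $f:X\to\kappa$ ($\kappa$ discrete) with $f(x)\ne f(y)$ for all $(x,y)\in G$, if such a $\kappa$ exists, and $2^{\aleph_0}$ otherwise. A space is 0DMS (resp. 0DP) if it is zero-dimensional (it has a basis of clopen sets), metrizable and separable (resp. zero-dimensional and Polish). For a class $\Gamma$ of graphs on topological spaces, a $\preceq^i_c$-basis for $\Gamma$ is a subclass $\mathfrak B\subseteq\Gamma$ such that every element of $\Gamma$ is $\preceq^i_c$-above an element of $\mathfrak B$; it is an antichain basis if moreover distinct elements of $\mathfrak B$ are $\preceq^i_c$-incomparable. Two graphs are $\preceq^i_c$-incompatible in $\Gamma$ if no element of $\Gamma$ is $\preceq^i_c$-below both. Let $\mathcal N:=(\{c,a,\overline a\}\cup\omega)^\omega$, with the product of the discrete topologies, where $c,a,\overline a$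 are distinct letters not in $\omega$; $x^n$ and $x^\infty$ denote finite and infinite repetition of the letter $x$, and juxtaposition denotes concatenation. Let $\mathbb G_m$ be the symmetrization of $$\begin{aligned}\mathbb O_m:=\;&\{(c^{k+1}a^{j+1}\overline a^\infty,\;k0^{j+1}\overline a^\infty)\mid j,k\in\omega\}\\ \cup\;&\{(ki^{j+1}a^\infty,\;k(i+1)^{j+1}\overline a^\infty)\mid j,k\in\omega,\ i\le 2k\}\\ \cup\;&\{(k(2k+1)^{j+1}a^\infty,\;c^{k+1}\overline a^{j+1}a^\infty)\mid j,k\in\omega\},\end{aligned}$$ let $\mathrm{proj}[\mathbb G_m]$ be the set of $x\in\mathcal N$ with $(x,y)\in\mathbb G_m$ for some $y$, and let $$\mathbb P:=\overline{\mathrm{proj}[\mathbb G_m]}\setminus\{c^{k+1}\varepsilon^\infty\mid k\in\omega,\ \varepsilon\in\{a,\overline a\}\}$$ with the subspace topology, so that $\mathbb G_m$ is a graph on $\mathbb P$. **Theorem 1.8.** Let $G$ be a graph on a 0DMS space $Z$ with CCN at least three and $(Z,G)\preceq^i_c(\mathbb P,\mathbb G_m)$. Then there is a family $\big((P_\alpha,G_\alpha)\big)_{\alpha\in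 2^\omega}$ of graphs on 0DP spaces, each with CCN three and each satisfying $(P_\alpha,G_\alpha)\preceq^i_c(Z,G)$, such that for all $\alpha\ne\beta$ the graphs $(P_\alpha,G_\alpha)$ and $(P_\beta,G_\beta)$ are $\preceq^i_c$-incompatible in the class of graphs on a 0DMS space with CCN at least three. In particular, there is no $\preceq^i_c$-antichain basis for the class of graphs on a 0DMS space with CCN at least three, nor for the class of graphs on a 0DP space with CCN at least three, and any $\preceq^i_c$-basis for either of these classes has size at least continuum. -/

import Mathlib

open Set Topology TopologicalSpace Cardinal

universe u v

/-- A graph (symmetric irreflexive relation) on a topological space. -/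
structure TopGraph : Type (u + 1) where
  /-- The underlying space. -/
  carrier : Type u
  [top : TopologicalSpace carrier]
  /-- The graph on the space; no compatibility with the topology is required. -/
  graph : SimpleGraph carrier

namespace TopGraph

attribute [instance] TopGraph.top

/-- `(X,G) ≼ᶜⁱ (Y,H)`: there is an injective continuous `φ : X → Y` with
`G ⊆ (φ × φ)⁻¹(H)`. -/
def InjLE (G : TopGraph.{u}) (H : TopGraph.{v}) : Prop :=
  ∃ φ : G.graph →g H.graph, Continuous φ ∧ Function.Injective φ

/-- There is a continuous coloring of the graph with colors in `α`, where `α` carries the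
discrete topology. -/
def ContColorable (G : TopGraph.{u}) (α : Type) : Prop :=
  ∃ c : G.graph.Coloring α, @Continuous G.carrier α G.top ⊥ c

/-- The countable cardinals `κ` for which there is a continuous coloring in `κ` colors. -/
def contColorCards (G : TopGraph.{u}) : Set Cardinal.{0} :=
  {κ | κ ≤ ℵ₀ ∧ ∃ α : Type, #α = κ ∧ G.ContColorable α}

open Classical in
/-- The continuous chromatic number (CCN): the least `κ ≤ ℵ₀` for which there is a continuous
coloring in `κ` colors if there is one, and `2^ℵ₀` otherwise. -/
noncomputable def ccn (G : TopGraph.{u}) : Cardinal.{0} :=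
  if G.contColorCards.Nonempty then sInf G.contColorCards else 𝔠

/-- The space is zero-dimensional, i.e. its clopen subsets form a basis of the topology. (The
Hausdorff property comes with metrizability wherever this is used.) -/
def IsZeroDim (G : TopGraph.{u}) : Prop :=
  IsTopologicalBasis {s : Set G.carrier | IsClopen s}

/-- The space is zero-dimensional, metrizable and separable. -/
def Is0DMS (G : TopGraph.{u}) : Prop :=
  G.IsZeroDim ∧ MetrizableSpace G.carrier ∧ SeparableSpace G.carrier

/-- The space is zero-dimensional and Polish. -/
def Is0DP (G : TopGraph.{u}) : Prop :=
  G.IsZeroDim ∧ PolishSpace G.carrier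

/-- The class of graphs on a zero-dimensional metrizable separable space with CCN at least
three. -/
def class0DMS : Set TopGraph.{u} := {G | G.Is0DMS ∧ 3 ≤ G.ccn}

/-- The class of graphs on a zero-dimensional Polish space with CCN at least three. -/
def class0DP : Set TopGraph.{u} := {G | G.Is0DP ∧ 3 ≤ G.ccn}

/-- `B` is a `≼ᶜⁱ`-basis for the class `Γ`: a subclass of `Γ` such that any element of `Γ` is
above an element of `B`. -/
def IsBasisFor (Γ B : Set TopGraph.{u}) : Prop :=
  B ⊆ Γ ∧ ∀ G ∈ Γ, ∃ H ∈ B, H.InjLE G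

/-- A `≼ᶜⁱ`-antichain basis for `Γ`: a basis whose elements are pairwise incomparable. -/
def IsAntichainBasisFor (Γ B : Set TopGraph.{u}) : Prop :=
  IsBasisFor Γ B ∧ IsAntichain (fun G H : TopGraph.{u} => G.InjLE H) B

/-- `G` and `H` are `≼ᶜⁱ`-incompatible in `Γ`: no element of `Γ` is below both. -/
def Incompatible (Γ : Set TopGraph.{u}) (G H : TopGraph.{u}) : Prop :=
  ¬ ∃ K ∈ Γ, K.InjLE G ∧ K.InjLE H

end TopGraph

namespace Gm

/-- The alphabet `{c, a, ā} ∪ ω`. -/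
inductive Letter : Type
  | c : Letter
  | a : Letter
  | abar : Letter
  | num : ℕ → Letter

/-- The alphabet is discrete. -/
instance : TopologicalSpace Letter := ⊥

instance : DiscreteTopology Letter := ⟨rfl⟩

/-- The space `𝒩 = ({c, a, ā} ∪ ω)^ω` with the product topology, a copy of the Baire space. -/
abbrev Seq : Type := ℕ → Letter

/-- The sequence `w x^∞`: the finite word `w` followed by the constant sequence `x`. -/
def wordThen (w : List Letter) (x : Letter) : Seq := fun n => w.getD n x

open Letter List

/-- The oriented graph `𝕆_m` on `𝒩`. -/
inductive Om : Seq → Seq → Prop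
  /-- `(c^{k+1} a^{j+1} ā^∞, k 0^{j+1} ā^∞)` -/
  | first (j k : ℕ) :
      Om (wordThen (replicate (k + 1) c ++ replicate (j + 1) a) abar)
        (wordThen (num k :: replicate (j + 1) (num 0)) abar)
  /-- `(k i^{j+1} a^∞, k (i+1)^{j+1} ā^∞)` for `i ≤ 2k` -/
  | middle (j k i : ℕ) (hi : i ≤ 2 * k) :
      Om (wordThen (num k :: replicate (j + 1) (num i)) a)
        (wordThen (num k :: replicate (j + 1) (num (i + 1))) abar)
  /-- `(k (2k+1)^{j+1} a^∞, c^{k+1} ā^{j+1} a^∞)` -/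
  | last (j k : ℕ) :
      Om (wordThen (num k :: replicate (j + 1) (num (2 * k + 1))) a)
        (wordThen (replicate (k + 1) c ++ replicate (j + 1) abar) a)

theorem Om.ne {x y : Seq} (h : Om x y) : x ≠ y := by
  intro e
  cases h with
  | first j k => simpa [wordThen, replicate_succ] using congrFun e 0
  | middle j k i hi => simpa [wordThen, replicate_succ] using congrFun e 1
  | last j k => simpa [wordThen, replicate_succ] using congrFun e 0

/-- The graph `𝔾_m` on `𝒩`, the symmetrization of `𝕆_m`. -/
def graphN : SimpleGraph Seq where
  Adj x y := Om x y ∨ Om y x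
  symm := ⟨fun _ _ h => h.symm⟩
  loopless := ⟨fun _ h => h.elim (fun h => h.ne rfl) (fun h => h.ne rfl)⟩

/-- The set `ℙ`: the closure of the projection `proj[𝔾_m]`, i.e. the set of points on some edge,
minus the points `c^{k+1} a^∞` and `c^{k+1} ā^∞`. -/
def setP : Set Seq :=
  closure graphN.support \ {x | ∃ k : ℕ, ∃ e : Letter, (e = a ∨ e = abar) ∧
    x = wordThen (replicate (k + 1) c) e}

/-- The graph `(ℙ, 𝔾_m)`, where `ℙ` carries the subspace topology. -/
def graphP : TopGraph.{0} where
  carrier := setP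
  graph := graphN.induce setP

end Gm

-- The proof replaces `(ℙ, 𝔾_m)` by a combinatorial model. For `S ⊆ ω`, `Space.model S` has, for
-- each `k ∈ S`, a closed chain of `2k+3` quasi-edges through a common point `top`. A quasi-edge is
-- a sequence of disjoint edges whose two ends converge to consecutive nodes. At `top` the
-- convergence is only along `k → ∞`, so a finite set of cycles carries no obstruction to a
-- 2-coloring, while infinitely many odd cycles do. Decoding sequences puts `(ℙ, 𝔾_m)` below `model
-- univ` (`Gm.graphP_injLE`).
--
-- Two facts carry the argument. By `Space.exists_model_injLE`, a first countable graph below `model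
-- S` that has no continuous 2-coloring is above `model R` for some infinite `R ⊆ S`: if every cycle
-- were broken near some quasi-edge, the breaks would allow a 2-coloring; hence infinitely many
-- cycles survive, and thinning them out gives a copy of a model. By
-- `Space.eventually_mem_of_injLE`, `model R ≼ model T` with `R` infinite forces `R ⊆ T` up to a
-- finite set, because almost every cycle must go onto a cycle of the same length.
--
-- Hence a graph below both `model A` and `model B` with CCN at least three yields an infinite `Q ⊆
-- A` almost contained in `B`, which is impossible when `A ∩ B` is finite. An almost disjoint family
-- of size continuum inside `R` gives the required graphs, and the statements on bases follow
-- formally.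

universe w

/-! ### Fan topologies: zero-dimensional, and Polish when countable. -/

/-- A topology in which the fixed points of `r` form a closed discrete set, all other points are
isolated, and the points `y` with `r y = x` converge to `x` as `l y` tends to infinity. -/
structure IsFan {X : Type*} [TopologicalSpace X] (r : X → X) (l : X → ℕ) : Prop where
  idem : ∀ x, r (r x) = r x
  isOpen_iff : ∀ U : Set X, IsOpen U ↔
    ∀ x ∈ U, r x = x → ∃ n, ∀ y, r y = x → n ≤ l y → y ∈ U

/-- The topology determined by a root function `r` and a level function `l`. -/
@[reducible] def fanTopology {X : Type*} (r : X → X) (l : X → ℕ) : TopologicalSpace X where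
  IsOpen U := ∀ x ∈ U, r x = x → ∃ n, ∀ y, r y = x → n ≤ l y → y ∈ U
  isOpen_univ := fun _ _ _ => ⟨0, fun _ _ _ => mem_univ _⟩
  isOpen_inter := by
    intro s t hs ht x hx hr
    obtain ⟨m, hm⟩ := hs x hx.1 hr
    obtain ⟨n, hn⟩ := ht x hx.2 hr
    exact ⟨max m n, fun y hy hl =>
      ⟨hm y hy ((le_max_left _ _).trans hl), hn y hy ((le_max_right _ _).trans hl)⟩⟩
  isOpen_sUnion := by
    rintro s hs x ⟨t, ht, hx⟩ hr
    obtain ⟨n, hn⟩ := hs t ht x hx hr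
    exact ⟨n, fun y hy hl => ⟨t, ht, hn y hy hl⟩⟩

namespace IsFan

variable {X : Type*} [TopologicalSpace X] {r : X → X} {l : X → ℕ}

theorem isOpen_singleton (h : IsFan r l) {x : X} (hx : r x ≠ x) : IsOpen ({x} : Set X) := by
  rw [h.isOpen_iff]
  rintro y rfl hy
  exact absurd hy hx

theorem isClosed_singleton (h : IsFan r l) (x : X) : IsClosed ({x} : Set X) := by
  rw [← isOpen_compl_iff, h.isOpen_iff]
  intro y _ _
  refine ⟨l x + 1, ?_⟩
  rintro z _ hl rfl
  omega

theorem isOpen_root_preimage (h : IsFan r l) (s : Set X) : IsOpen (r ⁻¹' s) := by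
  rw [h.isOpen_iff]
  intro x hx hr
  refine ⟨0, fun y hy _ => ?_⟩
  rw [mem_preimage, hy, ← hr]
  exact hx

theorem isClopen_tail (h : IsFan r l) (x : X) (n : ℕ) :
    IsClopen ({y | r y = x ∧ (y = x ∨ n ≤ l y)} : Set X) := by
  constructor
  · rw [← isOpen_compl_iff, h.isOpen_iff]
    intro p hp hr
    refine ⟨0, fun y hy _ hy' => hp ?_⟩
    have hpx : p = x := hy.symm.trans hy'.1
    exact ⟨hr.trans hpx, Or.inl hpx⟩
  · rw [h.isOpen_iff]
    intro p hp hr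
    have hpx : p = x := hr.symm.trans hp.1
    exact ⟨n, fun y hy hl => ⟨hy.trans hpx, Or.inr hl⟩⟩

theorem mem_nhds_iff (h : IsFan r l) {x : X} (hx : r x = x) {U : Set X} :
    U ∈ 𝓝 x ↔ x ∈ U ∧ ∃ n, ∀ y, r y = x → n ≤ l y → y ∈ U := by
  constructor
  · intro hU
    obtain ⟨V, hVU, hV, hxV⟩ := _root_.mem_nhds_iff.1 hU
    obtain ⟨n, hn⟩ := (h.isOpen_iff V).1 hV x hxV hx
    exact ⟨hVU hxV, n, fun y hy hl => hVU (hn y hy hl)⟩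
  · rintro ⟨hxU, n, hn⟩
    refine Filter.mem_of_superset ((h.isClopen_tail x n).isOpen.mem_nhds ⟨hx, Or.inl rfl⟩) ?_
    rintro y ⟨hy, rfl | hl⟩
    · exact hxU
    · exact hn y hy hl

theorem continuous_iff (h : IsFan r l) {Y : Type*} [TopologicalSpace Y] {f : X → Y} :
    Continuous f ↔
      ∀ x, r x = x → ∀ V ∈ 𝓝 (f x), ∃ n, ∀ y, r y = x → n ≤ l y → f y ∈ V := by
  constructor
  · intro hf x hx V hV
    exact ((h.mem_nhds_iff hx).1 (hf.continuousAt hV)).2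
  · intro hf
    rw [continuous_iff_continuousAt]
    intro x
    by_cases hx : r x = x
    · intro V hV
      exact (h.mem_nhds_iff hx).2 ⟨mem_preimage.2 (mem_of_mem_nhds hV), hf x hx V hV⟩
    · intro V hV
      rw [Filter.mem_map]
      refine Filter.mem_of_superset ((h.isOpen_singleton hx).mem_nhds rfl) ?_
      rintro y rfl
      exact mem_preimage.2 (mem_of_mem_nhds hV)

theorem isTopologicalBasis_isClopen (h : IsFan r l) :
    IsTopologicalBasis {s : Set X | IsClopen s} := by
  refine isTopologicalBasis_of_isOpen_of_nhds (fun s hs => hs.isOpen) ?_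
  intro x U hx hU
  by_cases hr : r x = x
  · obtain ⟨n, hn⟩ := (h.isOpen_iff U).1 hU x hx hr
    refine ⟨_, h.isClopen_tail x n, ⟨hr, Or.inl rfl⟩, ?_⟩
    rintro y ⟨hy, rfl | hl⟩
    · exact hx
    · exact hn y hy hl
  · exact ⟨{x}, ⟨h.isClosed_singleton x, h.isOpen_singleton hr⟩, rfl, by simpa using hx⟩

/-- The truncation of a point at level `n`. -/
def trunc (r : X → X) (l : X → ℕ) (n : ℕ) (x : X) : X := if l x < n then x else r x

theorem trunc_of_root_eq {X : Type*} {r : X → X} {l : X → ℕ} {x : X} (hx : r x = x)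
    (n : ℕ) : trunc r l n x = x := by
  unfold trunc; split_ifs <;> simp [hx]

theorem trunc_trunc (h : IsFan r l) {m n : ℕ} (hmn : m ≤ n) (x : X) :
    trunc r l m (trunc r l n x) = trunc r l m x := by
  by_cases h1 : l x < n
  · simp [trunc, h1]
  · have h2 : trunc r l n x = r x := by simp [trunc, h1]
    rw [h2, trunc_of_root_eq (h.idem x)]
    have : ¬ l x < m := by omega
    simp [trunc, this]

theorem eq_of_trunc_eq (h : IsFan r l) {n : ℕ} {x w : X} (hw : r w ≠ w)
    (hx : trunc r l n x = w) : x = w := by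
  unfold trunc at hx
  split_ifs at hx
  · exact hx
  · exact absurd (hx ▸ h.idem x) hw

theorem continuous_trunc (h : IsFan r l) {Y : Type*} [TopologicalSpace Y] (f : X → Y) (n : ℕ) :
    Continuous fun x => f (trunc r l n x) := by
  rw [h.continuous_iff]
  intro x hx V hV
  refine ⟨n, fun y hy hl => ?_⟩
  have : trunc r l n y = x := by simp [trunc, not_lt.2 hl, hy]
  simp only [this]
  rw [trunc_of_root_eq hx] at hV
  exact mem_of_mem_nhds hV

/-- Truncation at a level above `l x` fixes `x`, so the truncations separate points. The image of a
closed set is closed because a coherent sequence of truncations either reaches an isolated point and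
stabilizes, or is constantly one root. -/
theorem isClosedEmbedding_trunc (h : IsFan r l) {f : X → ℕ} (hf : Function.Injective f) :
    IsClosedEmbedding fun x n => f (trunc r l n x) := by
  refine IsClosedEmbedding.of_continuous_injective_isClosedMap
    (continuous_pi fun n => h.continuous_trunc f n) ?_ ?_
  · intro x y hxy
    have := hf (congrFun hxy (max (l x) (l y) + 1))
    simpa [trunc, Nat.lt_succ_iff] using this
  · intro C hC
    refine isClosed_of_closure_subset fun y hy => ?_
    have key : ∀ n, ∃ x ∈ C, ∀ m ≤ n, f (trunc r l m x) = y m := by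
      intro n
      have hU : IsOpen (⋂ m ∈ Finset.range (n + 1), {z : ℕ → ℕ | z m = y m}) :=
        isOpen_biInter_finset fun m _ =>
          (isOpen_discrete ({y m} : Set ℕ)).preimage
            (continuous_apply (A := fun _ : ℕ => ℕ) m)
      obtain ⟨_, hz, x, hx, rfl⟩ := _root_.mem_closure_iff.1 hy _ hU (by simp)
      refine ⟨x, hx, fun m hm => ?_⟩
      simp only [Finset.mem_range, mem_iInter, mem_ofPred_eq] at hz
      exact hz m (by omega)
    choose x hxC hx using key
    have comp : ∀ m n, m ≤ n → trunc r l m (x n) = trunc r l m (x m) := fun m n hmn =>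
      hf ((hx n m hmn).trans (hx m m le_rfl).symm)
    by_cases hiso : ∃ n, r (trunc r l n (x n)) ≠ trunc r l n (x n)
    · obtain ⟨n, hn⟩ := hiso
      have heq : ∀ m, n ≤ m → x m = x n := fun m hm =>
        (h.eq_of_trunc_eq hn (comp n m hm)).trans (h.eq_of_trunc_eq hn rfl).symm
      refine ⟨x n, hxC n, funext fun m => ?_⟩
      rcases le_total m n with hmn | hmn
      · exact hx n m hmn
      · simp only [← heq m hmn]
        exact hx m m le_rfl
    · push Not at hiso
      set p := trunc r l 0 (x 0) with hp
      have hall : ∀ n, trunc r l n (x n) = p := by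
        intro n
        have h1 := comp 0 n (Nat.zero_le n)
        rw [← h.trunc_trunc (Nat.zero_le n), trunc_of_root_eq (hiso n)] at h1
        exact h1
      have hpr : r p = p := hiso 0
      refine ⟨p, ?_, funext fun m => ?_⟩
      -- Each `x n` is either `p` itself or a point attached to `p` of level at least `n`, so a
      -- closed set containing all of them contains `p`.
      · by_contra hpC
        obtain ⟨n, hn⟩ := (h.isOpen_iff _).1 hC.isOpen_compl p hpC hpr
        have h1 := hall n
        unfold trunc at h1
        split_ifs at h1 with h2
        · exact hpC (h1 ▸ hxC n)
        · exact hn (x n) h1 (not_lt.1 h2) (hxC n)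
      · simp only [trunc_of_root_eq hpr]
        rw [← hall m]
        exact hx m m le_rfl

theorem polishSpace (h : IsFan r l) [Countable X] : PolishSpace X := by
  obtain ⟨f, hf⟩ := exists_injective_nat X
  exact (h.isClosedEmbedding_trunc hf).polishSpace

end IsFan

/-! ### Chromatic number and two-colorability. -/

namespace TopGraph

theorem contColorable_iff {G : TopGraph.{u}} {α : Type} :
    G.ContColorable α ↔ ∃ c : G.graph.Coloring α, ∀ a, IsOpen {x | c x = a} := by
  refine exists_congr fun c => ?_
  let : TopologicalSpace α := ⊥
  have : DiscreteTopology α := ⟨rfl⟩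
  exact continuous_discrete_rng

theorem ContColorable.of_injective {G : TopGraph.{u}} {α β : Type} (h : G.ContColorable α)
    {f : α → β} (hf : Function.Injective f) : G.ContColorable β := by
  obtain ⟨c, hc⟩ := h
  refine ⟨SimpleGraph.Coloring.mk (fun x => f (c x)) fun {x y} hxy e => c.valid hxy (hf e), ?_⟩
  let : TopologicalSpace α := ⊥
  let : TopologicalSpace β := ⊥
  have : DiscreteTopology α := ⟨rfl⟩
  exact (continuous_of_discreteTopology (f := f)).comp hc

theorem three_le_ccn_iff {G : TopGraph.{u}} : 3 ≤ G.ccn ↔ ¬ G.ContColorable Bool := by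
  constructor
  · intro h hB
    have hmem : (2 : Cardinal.{0}) ∈ G.contColorCards :=
      ⟨(natCast_lt_aleph0 (n := 2)).le, Bool, by simp, hB⟩
    rw [ccn, if_pos ⟨_, hmem⟩] at h
    have := h.trans (csInf_le' hmem)
    exact absurd this (by norm_num)
  · intro h
    unfold ccn
    split_ifs with hne
    · refine le_csInf hne ?_
      rintro κ ⟨-, α, rfl, hα⟩
      by_contra hlt
      have hle : #α ≤ #Bool := by
        rw [mk_bool, ← not_lt]
        intro h2
        have h3 := Order.succ_le_of_lt h2
        rw [← Nat.cast_ofNat, succ_natCast] at h3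
        exact hlt (by exact_mod_cast h3)
      obtain ⟨f⟩ := hle
      exact h (hα.of_injective f.injective)
    · exact (nat_lt_continuum 3).le

theorem ccn_le_three {G : TopGraph.{u}} (h : G.ContColorable (Fin 3)) : G.ccn ≤ 3 := by
  have hmem : (3 : Cardinal.{0}) ∈ G.contColorCards :=
    ⟨(natCast_lt_aleph0 (n := 3)).le, Fin 3, by simp, h⟩
  rw [ccn, if_pos ⟨_, hmem⟩]
  exact csInf_le' hmem

theorem InjLE.trans {G : TopGraph.{u}} {H : TopGraph.{v}} {K : TopGraph.{w}} (h : G.InjLE H)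
    (h' : H.InjLE K) : G.InjLE K := by
  obtain ⟨f, hf, hfi⟩ := h
  obtain ⟨g, hg, hgi⟩ := h'
  exact ⟨g.comp f, hg.comp hf, hgi.comp hfi⟩

theorem InjLE.contColorable {G : TopGraph.{u}} {H : TopGraph.{v}} {α : Type} (h : G.InjLE H)
    (hH : H.ContColorable α) : G.ContColorable α := by
  obtain ⟨f, hf, -⟩ := h
  obtain ⟨c, hc⟩ := hH
  refine ⟨c.comp f, ?_⟩
  let : TopologicalSpace α := ⊥
  exact hc.comp hf

end TopGraph

/-! ### The models: odd cycles of quasi-edges through one point. -/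

/-- The points of the countable space carrying a cycle of length `2k+3` for each `k`, all the
cycles passing through `top`. -/
inductive Pt : Type
  | top : Pt
  | lim (k n : ℕ) : Pt
  | pt (k e j : ℕ) (b : Bool) : Pt

namespace Pt

instance : Countable Pt := by
  have : Function.Injective (fun x : Pt => match x with
    | top => ([] : List ℕ)
    | lim k n => [k, n]
    | pt k e j b => [k, e, j, b.toNat]) := by
    rintro (_ | ⟨k, n⟩ | ⟨k, e, j, b⟩) (_ | ⟨k', n'⟩ | ⟨k', e', j', b'⟩) h <;> simp_all
    cases b <;> cases b' <;> simp_all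
  exact this.countable

/-- The `n`-th node of the `k`-th cycle, whose first and last nodes are `top`. -/
def node (k n : ℕ) : Pt := if n = 0 ∨ n = 2 * k + 3 then top else lim k n

/-- The node to which a point is attached. -/
def root : Pt → Pt
  | top => top
  | lim k n => lim k n
  | pt k e _ b => node k (e + b.toNat)

/-- The level of a point attached to a node. -/
def level : Pt → ℕ
  | top => 0
  | lim _ _ => 0
  -- At the ends of a cycle the level is `k`, not `j`: for fixed `k` these points do not accumulate
  -- at `top`; they approach it only as `k` grows.
  | pt k e j b => if e + b.toNat = 0 ∨ e + b.toNat = 2 * k + 3 then k else j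

/-- The points lying on the cycles with index in `S`. -/
def Valid (S : Set ℕ) : Pt → Prop
  | top => True
  | lim k n => k ∈ S ∧ 1 ≤ n ∧ n ≤ 2 * k + 2
  | pt k e _ _ => k ∈ S ∧ e ≤ 2 * k + 2

theorem node_of_end {k n : ℕ} (h : n = 0 ∨ n = 2 * k + 3) : node k n = top := if_pos h

theorem node_of_mid {k n : ℕ} (h : 1 ≤ n) (h' : n ≤ 2 * k + 2) : node k n = lim k n :=
  if_neg (by omega)

theorem root_node (k n : ℕ) : root (node k n) = node k n := by
  unfold node; split_ifs <;> rfl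

theorem root_root (x : Pt) : root (root x) = root x := by
  cases x with
  | top => rfl
  | lim k n => rfl
  | pt k e j b => exact root_node _ _

theorem node_ne_pt (k n k' e j : ℕ) (b : Bool) : node k n ≠ pt k' e j b := by
  unfold node; split_ifs <;> simp

theorem valid_node {S : Set ℕ} {k n : ℕ} (hk : k ∈ S) (hn : n ≤ 2 * k + 3) :
    Valid S (node k n) := by
  unfold node
  split_ifs with h
  · trivial
  · exact ⟨hk, by omega, by omega⟩

theorem valid_root {S : Set ℕ} {x : Pt} (h : Valid S x) : Valid S (root x) := by
  cases x with
  | top => trivial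
  | lim k n => exact h
  | pt k e j b =>
    refine valid_node h.1 ?_
    have := h.2
    have := b.toNat_le
    omega

theorem Valid.mono {S T : Set ℕ} (hST : S ⊆ T) {x : Pt} (h : Valid S x) : Valid T x := by
  cases x with
  | top => trivial
  | lim k n => exact ⟨hST h.1, h.2⟩
  | pt k e j b => exact ⟨hST h.1, h.2⟩

end Pt

open Pt

/-- The space of the points lying on the cycles with index in `S`. -/
def Space (S : Set ℕ) : Type := {x : Pt // Valid S x}

namespace Space

variable {S T : Set ℕ}

/-- `Pt.root` on `Space S`. -/
def rt (x : Space S) : Space S := ⟨root x.1, valid_root x.2⟩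

/-- `Pt.level` on `Space S`. -/
def lev (x : Space S) : ℕ := level x.1

instance : TopologicalSpace (Space S) := fanTopology rt lev

instance : Countable (Space S) := inferInstanceAs (Countable {x : Pt // Valid S x})

theorem isFan : IsFan (rt (S := S)) lev where
  idem x := Subtype.ext (root_root x.1)
  isOpen_iff _ := Iff.rfl

/-- The common point of all the cycles. -/
def tp (S : Set ℕ) : Space S := ⟨top, trivial⟩

/-- `Pt.node` on `Space S`. -/
def nd {k n : ℕ} (hk : k ∈ S) (hn : n ≤ 2 * k + 3) : Space S := ⟨node k n, valid_node hk hn⟩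

/-- `Pt.pt` on `Space S`. -/
def mk {k e : ℕ} (hk : k ∈ S) (he : e ≤ 2 * k + 2) (j : ℕ) (b : Bool) : Space S :=
  ⟨pt k e j b, hk, he⟩

/-- The graph on `Space S`: the two points of each pair `pt k e j false`, `pt k e j true` are
joined. -/
def graph (S : Set ℕ) : SimpleGraph (Space S) where
  Adj x y := ∃ k e j b, x.1 = pt k e j b ∧ y.1 = pt k e j (!b)
  symm := ⟨by
    rintro x y ⟨k, e, j, b, hx, hy⟩
    exact ⟨k, e, j, !b, hy, by simpa using hx⟩⟩
  loopless := ⟨by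
    rintro x ⟨k, e, j, b, hx, hy⟩
    rw [hx] at hy
    simp at hy⟩

/-- `Space S` with its graph. -/
def model (S : Set ℕ) : TopGraph.{0} where
  carrier := Space S
  graph := graph S

theorem adj_mk {k e : ℕ} (hk : k ∈ S) (he : e ≤ 2 * k + 2) (j : ℕ) :
    (graph S).Adj (mk hk he j false) (mk hk he j true) := ⟨k, e, j, false, rfl, rfl⟩

theorem is0DP (S : Set ℕ) : (model S).Is0DP :=
  ⟨(isFan (S := S)).isTopologicalBasis_isClopen, (isFan (S := S)).polishSpace⟩

/-- The inclusion map. -/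
def incl (h : S ⊆ T) : graph S →g graph T where
  toFun x := ⟨x.1, x.2.mono h⟩
  map_rel' := fun h => h

theorem continuous_incl (h : S ⊆ T) : Continuous (incl h) := by
  refine (isFan (S := S)).continuous_iff.2 ?_
  intro x hx V hV
  have hfx : rt (incl h x) = incl h x := Subtype.ext (congrArg Subtype.val hx :)
  obtain ⟨n, hn⟩ := ((isFan (S := T)).mem_nhds_iff hfx).1 hV |>.2
  exact ⟨n, fun y hy hl => hn _ (Subtype.ext (congrArg Subtype.val hy :)) hl⟩

theorem injective_incl (h : S ⊆ T) : Function.Injective (incl h) := fun _ _ hxy =>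
  Subtype.ext (congrArg Subtype.val hxy :)

theorem injLE_of_subset (h : S ⊆ T) : (model S).InjLE (model T) :=
  ⟨incl h, continuous_incl h, injective_incl h⟩

theorem ccn_le_three (S : Set ℕ) : (model S).ccn ≤ 3 := by
  apply TopGraph.ccn_le_three
  rw [TopGraph.contColorable_iff]
  let col : Pt → Fin 3 := fun x => match x with
    | top => 2
    | lim _ n => if Even n then 0 else 1
    -- Irrelevant value: `col` is only applied to roots.
    | pt _ _ _ _ => 0
  refine ⟨SimpleGraph.Coloring.mk (fun x : Space S => col (rt x).1) ?_, fun a =>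
    isFan.isOpen_root_preimage {x | col x.1 = a}⟩
  have key : ∀ k e, e ≤ 2 * k + 2 → col (node k e) ≠ col (node k (e + 1)) := by
    intro k e he
    unfold node
    split_ifs with h1 h2 h2
    · simp only [false_or] at h2; omega
    · simp only [col]; split_ifs <;> decide
    · simp only [col]; split_ifs <;> decide
    · simp only [col, Nat.even_add_one]; split_ifs <;> decide
  rintro ⟨x, hx⟩ ⟨y, hy⟩ ⟨k, e, j, b, h1, h2⟩
  simp only at h1 h2
  subst h1 h2
  cases b with
  | false => exact key k e hx.2
  | true => exact (key k e hx.2).symm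

/-- If `n` is an inner node, then the points attached to it converge to it. -/
theorem exists_forall_mk_mem {Y : Type*} [TopologicalSpace Y] {f : Space S → Y}
    (hf : Continuous f) {k n : ℕ} (hk : k ∈ S) (h1 : 1 ≤ n) (h2 : n ≤ 2 * k + 2) {V : Set Y}
    (hV : V ∈ 𝓝 (f (nd hk (h2.trans (Nat.le_succ _))))) :
    ∃ J, ∀ (e : ℕ) (he : e ≤ 2 * k + 2) (b : Bool) (j : ℕ), e + b.toNat = n → J ≤ j →
      f (mk hk he j b) ∈ V := by
  obtain ⟨J, hJ⟩ := isFan.continuous_iff.1 hf (nd hk _) (Subtype.ext (root_node k n)) V hV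
  refine ⟨J, fun e he b j hn hj => hJ _ (Subtype.ext ?_) ?_⟩
  · subst hn; rfl
  · have : level (pt k e j b) = j := if_neg (by omega)
    exact hj.trans this.ge

/-- The points attached to the ends of the cycles converge to `tp S`. -/
theorem exists_forall_mk_mem_top {Y : Type*} [TopologicalSpace Y] {f : Space S → Y}
    (hf : Continuous f) {V : Set Y} (hV : V ∈ 𝓝 (f (tp S))) :
    ∃ K, ∀ (k : ℕ) (hk : k ∈ S) (e : ℕ) (he : e ≤ 2 * k + 2) (b : Bool) (j : ℕ),
      (e + b.toNat = 0 ∨ e + b.toNat = 2 * k + 3) → K ≤ k → f (mk hk he j b) ∈ V := by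
  obtain ⟨K, hK⟩ := isFan.continuous_iff.1 hf (tp S) rfl V hV
  refine ⟨K, fun k hk e he b j hn hj => hK _ (Subtype.ext (node_of_end hn)) ?_⟩
  have : level (pt k e j b) = k := if_pos hn
  exact hj.trans this.ge

/-- For large `k` the ends of the `k`-th cycle have the color of `top`. Continuity at the inner
nodes makes the node colors alternate along the cycle, which returns to `top` after the odd number
`2k+3` of steps. -/
theorem not_contColorable (hS : S.Infinite) : ¬ (model S).ContColorable Bool := by
  rw [TopGraph.contColorable_iff]
  rintro ⟨c, hc⟩
  change (graph S).Coloring Bool at c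
  have hcont : Continuous (c : Space S → Bool) := continuous_discrete_rng.2 hc
  obtain ⟨K, hK⟩ := exists_forall_mk_mem_top hcont
    ((isOpen_discrete ({c (tp S)} : Set Bool)).mem_nhds rfl)
  obtain ⟨k, hk, hKk⟩ := hS.exists_gt K
  have loc : ∀ (n : ℕ) (hn : n ≤ 2 * k + 3), ∃ J, ∀ (e : ℕ) (he : e ≤ 2 * k + 2) (b : Bool)
      (j : ℕ), e + b.toNat = n → J ≤ j → c (mk hk he j b) = c (nd hk hn) := by
    intro n hn
    by_cases h : n = 0 ∨ n = 2 * k + 3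
    · refine ⟨0, fun e he b j hne _ => ?_⟩
      have : nd hk hn = tp S := Subtype.ext (node_of_end h)
      rw [this]
      exact hK k hk e he b j (hne ▸ h) hKk.le
    · obtain ⟨J, hJ⟩ := exists_forall_mk_mem hcont hk (by omega) (by omega)
        ((isOpen_discrete ({c (nd hk hn)} : Set Bool)).mem_nhds rfl)
      exact ⟨J, hJ⟩
  have alt : ∀ (n : ℕ) (hn : n ≤ 2 * k + 3),
      c (nd hk hn) = xor (c (tp S)) (decide (n % 2 = 1)) := by
    intro n
    induction n with
    | zero =>
      intro hn
      have : nd hk hn = tp S := Subtype.ext (node_of_end (k := k) (Or.inl rfl))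
      simp [this]
    | succ n ih =>
      intro hn
      have ih' := ih (by omega)
      obtain ⟨J, hJ⟩ := loc n (by omega)
      obtain ⟨J', hJ'⟩ := loc (n + 1) hn
      have hadj := c.valid (adj_mk hk (show n ≤ 2 * k + 2 by omega) (max J J'))
      rw [hJ n (by omega) false _ rfl (le_max_left _ _),
        hJ' n (by omega) true _ rfl (le_max_right _ _), ih'] at hadj
      rcases Nat.mod_two_eq_zero_or_one n with h | h
      · have h' : (n + 1) % 2 = 1 := by omega
        simp only [h, h'] at hadj ⊢
        revert hadj
        cases c (tp S) <;> cases c (nd hk hn) <;> simp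
      · have h' : (n + 1) % 2 = 0 := by omega
        simp only [h, h'] at hadj ⊢
        revert hadj
        cases c (tp S) <;> cases c (nd hk hn) <;> simp
  have hlast := alt (2 * k + 3) le_rfl
  have : nd hk (le_refl (2 * k + 3)) = tp S := Subtype.ext (node_of_end (Or.inr rfl))
  have hodd : (2 * k + 3) % 2 = 1 := by omega
  rw [this, hodd] at hlast
  revert hlast
  cases c (tp S) <;> simp

theorem ccn_eq_three (hS : S.Infinite) : (model S).ccn = 3 :=
  (ccn_le_three S).antisymm (TopGraph.three_le_ccn_iff.2 (not_contColorable hS))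

end Space

/-! ### A graph below a model with no continuous 2-coloring is above a model. -/

namespace Pt

theorem node_eq_top_iff {k n : ℕ} : node k n = top ↔ n = 0 ∨ n = 2 * k + 3 := by
  unfold node; split_ifs with h <;> simp [h]

theorem node_eq_lim_iff {k n k' n' : ℕ} :
    node k n = lim k' n' ↔ k = k' ∧ n = n' ∧ ¬ (n = 0 ∨ n = 2 * k + 3) := by
  unfold node; split_ifs with h <;> simp [h]

end Pt

namespace Space

variable {S : Set ℕ}

/-- The set `V` is a neighborhood of the `n`-th node of the `k`-th cycle as seen through `φ`,
where a neighborhood of an end of the cycle is a set containing `U`. -/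
def IsNodeNhd {Z : Type u} [TopologicalSpace Z] (φ : Z → Space S) (U : Set Z) (k n : ℕ)
    (V : Set Z) : Prop :=
  ((n = 0 ∨ n = 2 * k + 3) → U ⊆ V) ∧
    -- Vacuous when the node has no preimage; then even `∅` qualifies, and linkedness is used below
    -- to exclude this.
    (¬ (n = 0 ∨ n = 2 * k + 3) → ∀ z, (φ z).1 = lim k n → V ∈ 𝓝 z)

/-- Each quasi-edge of the `k`-th cycle is realized by edges of `G` arbitrarily close to its
end nodes. -/
def IsLinked {Z : Type u} [TopologicalSpace Z] (G : SimpleGraph Z) (φ : Z → Space S) (U : Set Z)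
    (k : ℕ) : Prop :=
  ∀ e ≤ 2 * k + 2, ∀ V W, IsNodeNhd φ U k e V → IsNodeNhd φ U k (e + 1) W →
    ∃ j, ∃ z ∈ V, ∃ w ∈ W, G.Adj z w ∧ (φ z).1 = pt k e j false ∧ (φ w).1 = pt k e j true

theorem IsNodeNhd.mono {Z : Type u} [TopologicalSpace Z] {φ : Z → Space S} {U U' : Set Z}
    (h : U' ⊆ U) {k n : ℕ} {V : Set Z} (hV : IsNodeNhd φ U k n V) : IsNodeNhd φ U' k n V :=
  ⟨fun hn => h.trans (hV.1 hn), hV.2⟩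

theorem IsLinked.mono {Z : Type u} [TopologicalSpace Z] {G : SimpleGraph Z} {φ : Z → Space S}
    {U U' : Set Z} (h : U' ⊆ U) {k : ℕ} (hl : IsLinked G φ U' k) : IsLinked G φ U k :=
  fun e he V W hV hW => hl e he V W (hV.mono h) (hW.mono h)

theorem isNodeNhd_univ {Z : Type u} [TopologicalSpace Z] (φ : Z → Space S) (U : Set Z)
    (k n : ℕ) : IsNodeNhd φ U k n univ :=
  ⟨fun _ => subset_univ _, fun _ _ _ => Filter.univ_mem⟩

-- If no cycle is linked, each cycle `k` has a quasi-edge `e k` without edges between suitable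
-- neighborhoods `V k` and `W k` of its end nodes. Cutting every cycle there leaves paths, which are
-- 2-colored consistently at `top`; the edges of the cut quasi-edges are then corrected away from
-- the nodes, which preserves continuity.
open Classical in
theorem exists_isLinked {Z : TopGraph.{u}} (hcol : ¬ Z.ContColorable Bool)
    (φ : Z.graph →g graph S) (hφ : Continuous φ) (hinj : Function.Injective φ)
    {U : Set Z.carrier} (hU : ∀ z, (φ z).1 = top → U ∈ 𝓝 z) : ∃ k, IsLinked Z.graph φ U k := by
  by_contra hcon
  simp only [IsLinked] at hcon
  push Not at hcon
  choose e he V W hV hW hno using hcon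
  apply hcol
  rw [TopGraph.contColorable_iff]
  -- Parity, shifted after the cut: the colors of the nodes alternate except across `e k`, so both
  -- ends of the cycle receive `false`.
  let q : ℕ → ℕ → Bool := fun k n => xor (decide (n % 2 = 1)) (decide (e k < n))
  let nc : Pt → Bool := fun x => match x with
    | top => false
    | lim k n => q k n
    | pt _ _ _ _ => false
  have hnc : ∀ k n, n ≤ 2 * k + 3 → nc (node k n) = q k n := by
    intro k n hn
    unfold node
    split_ifs with h
    · rcases h with rfl | rfl
      · simp [nc, q]
      · have h1 : (2 * k + 3) % 2 = 1 := by omega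
        have h2 : e k < 2 * k + 3 := by have := he k; omega
        simp [nc, q, h1, h2]
    · rfl
  have hq : ∀ k n, n ≠ e k → q k n ≠ q k (n + 1) := by
    intro k n hn
    have h1 : (e k < n) ↔ (e k < n + 1) := by omega
    rcases Nat.mod_two_eq_zero_or_one n with h | h
    · have h' : (n + 1) % 2 = 1 := by omega
      simp [q, h, h', h1]
    · have h' : (n + 1) % 2 = 0 := by omega
      simp [q, h, h', h1]
  have hqe : ∀ k, q k (e k) = q k (e k + 1) := by
    intro k
    rcases Nat.mod_two_eq_zero_or_one (e k) with h | h
    · have h' : (e k + 1) % 2 = 1 := by omega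
      simp [q, h, h']
    · have h' : (e k + 1) % 2 = 0 := by omega
      simp [q, h, h']
  -- The nodes of the cut quasi-edge share a color, so exactly one end of each of its edges must be
  -- flipped: the `false` end if it is outside `V k`, otherwise the `true` end, which is then
  -- outside `W k`. Flipped points thus stay away from the nodes to which they are attached.
  let Flip : Z.carrier → Prop := fun z => ∃ k j, ((φ z).1 = pt k (e k) j false ∧ z ∉ V k) ∨
    ((φ z).1 = pt k (e k) j true ∧ ∃ y ∈ V k, Z.graph.Adj y z ∧ (φ y).1 = pt k (e k) j false)
  let col : Z.carrier → Bool := fun z => xor (nc (root (φ z).1)) (decide (Flip z))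
  have hedge : ∀ z w k e' j, Z.graph.Adj z w → (φ z).1 = pt k e' j false →
      (φ w).1 = pt k e' j true → col z ≠ col w := by
    intro z w k e' j hadj hz hw
    have he' : e' ≤ 2 * k + 2 := by
      have := (φ z).2
      rw [hz] at this
      exact this.2
    have rz : root (φ z).1 = node k e' := by rw [hz]; rfl
    have rw' : root (φ w).1 = node k (e' + 1) := by rw [hw]; rfl
    simp only [col, rz, rw', hnc k e' (by omega), hnc k (e' + 1) (by omega)]
    by_cases hee : e' = e k
    · have fz : Flip z ↔ z ∉ V k := by
        constructor
        · rintro ⟨k', j', ⟨h1, h2⟩ | ⟨h1, -⟩⟩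
          · rw [hz] at h1
            simp only [pt.injEq] at h1
            rw [h1.1]; exact h2
          · rw [hz] at h1
            simp at h1
        · intro h
          exact ⟨k, j, Or.inl ⟨hee ▸ hz, h⟩⟩
      have fw : Flip w ↔ z ∈ V k := by
        constructor
        · rintro ⟨k', j', ⟨h1, -⟩ | ⟨h1, y, hy, -, hy2⟩⟩
          · rw [hw] at h1
            simp at h1
          · rw [hw] at h1
            simp only [pt.injEq] at h1
            obtain ⟨rfl, -, rfl, -⟩ := h1
            have : y = z := hinj (Subtype.ext (by rw [hy2, hz, hee]))
            rwa [← this]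
        · intro h
          exact ⟨k, j, Or.inr ⟨hee ▸ hw, z, h, hadj, hee ▸ hz⟩⟩
      simp only [fz, fw, hee, hqe k]
      by_cases h : z ∈ V k <;> simp [h]
    · have fz : ¬ Flip z := by
        rintro ⟨k', j', ⟨h1, -⟩ | ⟨h1, -⟩⟩ <;>
        · rw [hz] at h1
          simp only [pt.injEq] at h1
          obtain ⟨rfl, h1, -⟩ := h1
          exact hee h1
      have fw : ¬ Flip w := by
        rintro ⟨k', j', ⟨h1, -⟩ | ⟨h1, -⟩⟩ <;>
        · rw [hw] at h1
          simp only [pt.injEq] at h1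
          obtain ⟨rfl, h1, -⟩ := h1
          exact hee h1
      simpa [fz, fw] using hq k e' hee
  have hloc : ∀ z, ∀ᶠ y in 𝓝 z, col y = col z := by
    intro z
    by_cases hr : rt (φ z) = φ z
    · have hroot : root (φ z).1 = (φ z).1 := congrArg Subtype.val hr
      have hzF : ¬ Flip z := by
        rintro ⟨k', j', ⟨h1, -⟩ | ⟨h1, -⟩⟩ <;>
        · rw [h1] at hroot
          exact node_ne_pt _ _ _ _ _ _ hroot
      have ev1 : ∀ᶠ y in 𝓝 z, root (φ y).1 = (φ z).1 := by
        have : IsOpen (φ ⁻¹' (rt ⁻¹' {φ z})) := (isFan.isOpen_root_preimage _).preimage hφ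
        filter_upwards [this.mem_nhds hr] with y hy
        exact congrArg Subtype.val (show rt (φ y) = φ z from hy)
      have ev2 : ∀ᶠ y in 𝓝 z, root (φ y).1 = (φ z).1 → ¬ Flip y := by
        rcases hx : (φ z).1 with _ | ⟨k, n⟩ | ⟨k, n, j, b⟩
        · filter_upwards [hU z hx] with y hy hry
          rintro ⟨k, j, ⟨h1, h2⟩ | ⟨h1, y', h2, h3, h4⟩⟩
          · rw [h1] at hry
            exact h2 ((hV k).1 (node_eq_top_iff.1 hry) hy)
          · rw [h1] at hry
            exact hno k j y' h2 y ((hW k).1 (node_eq_top_iff.1 hry) hy) h3 h4 h1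
        · have hVn : n = e k → ¬ (n = 0 ∨ n = 2 * k + 3) → V k ∈ 𝓝 z := by
            rintro rfl h
            exact (hV k).2 h z hx
          have hWn : n = e k + 1 → ¬ (n = 0 ∨ n = 2 * k + 3) → W k ∈ 𝓝 z := by
            rintro rfl h
            exact (hW k).2 h z hx
          have e1 : ∀ᶠ y in 𝓝 z, n = e k → ¬ (n = 0 ∨ n = 2 * k + 3) → y ∈ V k := by
            by_cases h : n = e k ∧ ¬ (n = 0 ∨ n = 2 * k + 3)
            · filter_upwards [hVn h.1 h.2] with y hy _ _ using hy
            · exact Filter.Eventually.of_forall fun y h1 h2 => absurd ⟨h1, h2⟩ h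
          have e2 : ∀ᶠ y in 𝓝 z, n = e k + 1 → ¬ (n = 0 ∨ n = 2 * k + 3) → y ∈ W k := by
            by_cases h : n = e k + 1 ∧ ¬ (n = 0 ∨ n = 2 * k + 3)
            · filter_upwards [hWn h.1 h.2] with y hy _ _ using hy
            · exact Filter.Eventually.of_forall fun y h1 h2 => absurd ⟨h1, h2⟩ h
          filter_upwards [e1, e2] with y hy1 hy2 hry
          rintro ⟨k', j, ⟨h1, h2⟩ | ⟨h1, y', h2, h3, h4⟩⟩
          · rw [h1] at hry
            obtain ⟨rfl, h5, h6⟩ := node_eq_lim_iff.1 hry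
            exact h2 (hy1 h5.symm (h5 ▸ h6))
          · rw [h1] at hry
            obtain ⟨rfl, h5, h6⟩ := node_eq_lim_iff.1 hry
            exact hno k' j y' h2 y (hy2 h5.symm (h5 ▸ h6)) h3 h4 h1
        · rw [hx] at hroot
          exact absurd hroot (node_ne_pt _ _ _ _ _ _)
      filter_upwards [ev1, ev2] with y h1 h2
      simp [col, h1, hroot, h2 h1, hzF]
    · have : IsOpen (φ ⁻¹' {φ z}) := (isFan.isOpen_singleton hr).preimage hφ
      filter_upwards [this.mem_nhds rfl] with y hy
      rw [hinj (show φ y = φ z from hy)]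
  refine ⟨SimpleGraph.Coloring.mk col ?_, fun a => ?_⟩
  · intro z w hzw
    obtain ⟨k, e', j, b, h1, h2⟩ := φ.map_adj hzw
    cases b with
    | false => exact hedge z w k e' j hzw h1 h2
    | true => exact (hedge w z k e' j hzw.symm h2 h1).symm
  · rw [isOpen_iff_mem_nhds]
    intro z hz
    filter_upwards [hloc z] with y hy
    exact hy.trans hz

/-- If `top` is missed, `U = ∅` is admissible, and a linked cycle would have an edge with an end in
`∅`. -/
theorem exists_eq_tp {Z : TopGraph.{u}} (hcol : ¬ Z.ContColorable Bool)
    (φ : Z.graph →g graph S) (hφ : Continuous φ) (hinj : Function.Injective φ) :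
    ∃ z, (φ z).1 = top := by
  by_contra hcon
  push Not at hcon
  obtain ⟨k, hk⟩ := exists_isLinked hcol φ hφ hinj (U := ∅) fun z hz => absurd hz (hcon z)
  obtain ⟨j, z, hz, -⟩ := hk 0 (Nat.zero_le _) ∅ univ
    ⟨fun _ => subset_rfl, fun h => absurd (Or.inl rfl) h⟩ (isNodeNhd_univ _ _ _ _)
  exact hz

theorem frequently_isLinked {Z : TopGraph.{u}} (hcol : ¬ Z.ContColorable Bool)
    (φ : Z.graph →g graph S) (hφ : Continuous φ) (hinj : Function.Injective φ)
    {U : Set Z.carrier} (hU : ∀ z, (φ z).1 = top → U ∈ 𝓝 z) :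
    ∃ᶠ k in Filter.atTop, IsLinked Z.graph φ U k := by
  rw [Filter.frequently_atTop]
  intro K
  -- Shrinking `U` by this tail forces `K ≤ k`: the quasi-edge `0` of a linked cycle has an edge
  -- whose `false` end lies in the tail, and the level of that end is `k`.
  let C : Set (Space S) := {y | rt y = tp S ∧ (y = tp S ∨ K ≤ lev y)}
  have hC : IsOpen (φ ⁻¹' C) := (isFan.isClopen_tail (tp S) K).isOpen.preimage hφ
  obtain ⟨k, hk⟩ := exists_isLinked hcol φ hφ hinj (U := U ∩ φ ⁻¹' C) fun z hz => by
    have : φ z = tp S := Subtype.ext hz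
    exact Filter.inter_mem (hU z hz) (hC.mem_nhds ⟨by rw [this]; rfl, Or.inl this⟩)
  refine ⟨k, ?_, hk.mono inter_subset_left⟩
  obtain ⟨j, z, ⟨-, -, hz⟩, -, -, -, h1, -⟩ := hk 0 (Nat.zero_le _) (U ∩ φ ⁻¹' C) univ
    ⟨fun _ => subset_rfl, fun h => absurd (Or.inl rfl) h⟩ (isNodeNhd_univ _ _ _ _)
  rcases hz with hz | hz
  · rw [hz] at h1
    cases h1
  · have : lev (φ z) = k := by
      simp [lev, h1, level]
    exact this ▸ hz

/-- Shrinking bases of node neighborhoods. -/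
theorem exists_antitone_isNodeNhd {Z : Type u} [TopologicalSpace Z] [FirstCountableTopology Z]
    {φ : Z → Space S} (hφ : Continuous φ) (hinj : Function.Injective φ) (U : Set Z) (k n : ℕ)
    {z : Z} (hz : ¬ (n = 0 ∨ n = 2 * k + 3) → (φ z).1 = lim k n) :
    ∃ B : ℕ → Set Z, Antitone B ∧ (∀ l, IsNodeNhd φ U k n (B l)) ∧
      ((n = 0 ∨ n = 2 * k + 3) → ∀ l, B l ⊆ U) ∧
      (¬ (n = 0 ∨ n = 2 * k + 3) → (∀ N ∈ 𝓝 z, ∃ l, B l ⊆ N) ∧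
        ∀ l, ∀ y ∈ B l, ∀ e j b, (φ y).1 = pt k e j b → l ≤ j) := by
  by_cases hn : n = 0 ∨ n = 2 * k + 3
  · exact ⟨fun _ => U, antitone_const, fun l => ⟨fun _ => subset_rfl, fun h => absurd hn h⟩,
      fun _ _ => subset_rfl, fun h => absurd hn h⟩
  · have hz' := hz hn
    have hfix : rt (φ z) = φ z := Subtype.ext (by change root (φ z).1 = (φ z).1; rw [hz']; rfl)
    obtain ⟨B, hB⟩ := (𝓝 z).exists_antitone_basis
    let C : ℕ → Set Z := fun l => φ ⁻¹' {y | rt y = φ z ∧ (y = φ z ∨ l ≤ lev y)}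
    refine ⟨fun l => B l ∩ C l, ?_, ?_, fun h => absurd h hn, fun _ => ⟨?_, ?_⟩⟩
    · intro l m hlm y hy
      exact ⟨hB.antitone hlm hy.1, hy.2.1, hy.2.2.imp_right hlm.trans⟩
    · refine fun l => ⟨fun h => absurd h hn, fun _ y hy => ?_⟩
      have : y = z := hinj (Subtype.ext (hy.trans hz'.symm))
      subst this
      exact Filter.inter_mem (hB.mem l)
        (((isFan.isClopen_tail (φ y) l).isOpen.preimage hφ).mem_nhds ⟨hfix, Or.inl rfl⟩)
    · intro N hN
      obtain ⟨l, hl⟩ := hB.mem_iff.1 hN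
      exact ⟨l, inter_subset_left.trans hl⟩
    · rintro l y ⟨-, hy1, hy2⟩ e j b hy
      rcases hy2 with h | h
      · rw [← h, hy] at hz'
        cases hz'
      · have h3 : node k (e + b.toNat) = lim k n := by
          have := congrArg Subtype.val hy1
          change root (φ y).1 = _ at this
          rwa [hy, hz'] at this
        obtain ⟨-, -, h4⟩ := node_eq_lim_iff.1 h3
        have : lev (φ y) = j := by
          unfold lev
          rw [hy]
          exact if_neg h4
        exact this ▸ h

/-- Linkedness gives edges between arbitrarily small node neighborhoods; strict monotonicity of `σ`
keeps the chosen edges distinct. -/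
theorem IsLinked.exists_seq {Z : Type u} [TopologicalSpace Z] {G : SimpleGraph Z}
    {φ : Z → Space S} {U : Set Z} {k : ℕ} (h : IsLinked G φ U k) {e : ℕ} (he : e ≤ 2 * k + 2)
    {B : ℕ → ℕ → Set Z} (hanti : ∀ n, Antitone (B n)) (hB : ∀ n l, IsNodeNhd φ U k n (B n l))
    (hj : ∀ n, 1 ≤ n → n ≤ 2 * k + 2 → ∀ l, ∀ y ∈ B n l, ∀ e j b, (φ y).1 = pt k e j b → l ≤ j) :
    ∃ (σ : ℕ → ℕ) (p : Bool → ℕ → Z), StrictMono σ ∧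
      (∀ l, G.Adj (p false l) (p true l)) ∧
      ∀ b l, p b l ∈ B (e + b.toNat) l ∧ (φ (p b l)).1 = pt k e (σ l) b := by
  have hfreq : ∀ l, ∃ᶠ j in Filter.atTop, ∃ z ∈ B e l, ∃ w ∈ B (e + 1) l, G.Adj z w ∧
      (φ z).1 = pt k e j false ∧ (φ w).1 = pt k e j true := by
    intro l
    rw [Filter.frequently_atTop]
    intro J
    obtain ⟨j, z, hz, w, hw, hadj, h1, h2⟩ := h e he _ _ (hB e (max l J)) (hB (e + 1) (max l J))
    refine ⟨j, ?_, z, hanti _ (le_max_left _ _) hz, w, hanti _ (le_max_left _ _) hw, hadj, h1, h2⟩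
    refine (le_max_right l J).trans ?_
    -- A quasi-edge always has an inner end node, `e + 1` if `e = 0` and `e` otherwise; closeness to
    -- that node forces `j` to be large.
    by_cases h0 : e = 0
    · exact hj (e + 1) (by omega) (by omega) _ w hw _ _ _ h2
    · exact hj e (by omega) he _ z hz _ _ _ h1
  obtain ⟨σ, hσ, hp⟩ := Filter.extraction_forall_of_frequently hfreq
  choose z hz w hw hadj h1 h2 using hp
  refine ⟨σ, fun b => if b then w else z, hσ, fun l => by simpa using hadj l, ?_⟩
  rintro (_ | _) l
  · exact ⟨hz l, h1 l⟩
  · exact ⟨hw l, h2 l⟩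

/-- Cycles `κ i` linked over the shrinking neighborhoods `U i` of the preimage of `top` are
selected, and in each of their quasi-edges a sequence of edges converging to the inner nodes. The `U
i` give continuity at `top`, the sets `B i n` continuity at the inner nodes. -/
theorem exists_model_injLE {Z : TopGraph.{u}} [FirstCountableTopology Z.carrier]
    (hcol : ¬ Z.ContColorable Bool) (hZ : Z.InjLE (model S)) :
    ∃ R ⊆ S, R.Infinite ∧ (model R).InjLE Z := by
  obtain ⟨φ, hφ, hinj⟩ := hZ
  change Z.graph →g graph S at φ
  obtain ⟨z₀, hz₀⟩ := exists_eq_tp hcol φ hφ hinj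
  have hz₀' : ∀ z, (φ z).1 = top → z = z₀ := fun z hz =>
    hinj (Subtype.ext (hz.trans hz₀.symm))
  obtain ⟨U, hU⟩ := (𝓝 z₀).exists_antitone_basis
  obtain ⟨κ, hκ, hlink⟩ := Filter.extraction_forall_of_frequently fun n =>
    frequently_isLinked hcol φ hφ hinj (U := U n) fun z hz => by
      rw [hz₀' z hz]; exact hU.mem n
  -- Each inner node of a linked cycle has a preimage, since otherwise `∅` would be one of its
  -- neighborhoods.
  have hzz : ∀ i n, ∃ z, ¬ (n = 0 ∨ n = 2 * κ i + 3) → n ≤ 2 * κ i + 2 →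
      (φ z).1 = lim (κ i) n := by
    intro i n
    by_contra hcon
    push Not at hcon
    obtain ⟨h1, h2, -⟩ := hcon z₀
    obtain ⟨j, z, hz, -⟩ := hlink i n h2 ∅ univ
      ⟨fun h => absurd h (by simpa using h1), fun _ z hz => absurd hz (hcon z).2.2⟩
      (isNodeNhd_univ _ _ _ _)
    exact hz
  choose zz hzz using hzz
  have hB : ∀ i n, ∃ B : ℕ → Set Z.carrier, Antitone B ∧
      (∀ l, IsNodeNhd φ (U i) (κ i) n (B l)) ∧
      ((n = 0 ∨ n = 2 * κ i + 3) → ∀ l, B l ⊆ U i) ∧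
      (1 ≤ n → n ≤ 2 * κ i + 2 → (∀ N ∈ 𝓝 (zz i n), ∃ l, B l ⊆ N) ∧
        ∀ l, ∀ y ∈ B l, ∀ e j b, (φ y).1 = pt (κ i) e j b → l ≤ j) := by
    intro i n
    by_cases hn : n ≤ 2 * κ i + 3
    · obtain ⟨B, h1, h2, h3, h4⟩ := exists_antitone_isNodeNhd hφ hinj (U i) (κ i) n (z := zz i n)
        fun h => hzz i n h (by omega)
      exact ⟨B, h1, h2, h3, fun h h' => h4 (by omega)⟩
    · exact ⟨fun _ => univ, antitone_const, fun l => isNodeNhd_univ _ _ _ _,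
        fun h => absurd h (by omega), fun h h' => absurd h' (by omega)⟩
  choose B hanti hBn hBend hBmid using hB
  have hseq : ∀ i e, ∃ (σ : ℕ → ℕ) (p : Bool → ℕ → Z.carrier), e ≤ 2 * κ i + 2 →
      StrictMono σ ∧ (∀ l, Z.graph.Adj (p false l) (p true l)) ∧
      ∀ b l, p b l ∈ B i (e + b.toNat) l ∧ (φ (p b l)).1 = pt (κ i) e (σ l) b := by
    intro i e
    by_cases he : e ≤ 2 * κ i + 2
    · obtain ⟨σ, p, h⟩ := (hlink i).exists_seq he (B := B i) (hanti i) (hBn i)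
        fun n h1 h2 => (hBmid i n h1 h2).2
      exact ⟨σ, p, fun _ => h⟩
    · exact ⟨id, fun _ _ => z₀, fun h => absurd h he⟩
  choose σ p hσp using hseq
  obtain ⟨inv, hinv⟩ := hκ.injective.hasLeftInverse
  let ψ : Space (range κ) → Z.carrier := fun x => match x.1 with
    | top => z₀
    | lim k n => zz (inv k) n
    | pt k e j b => p (inv k) e b j
  -- `φ ∘ ψ` only reindexes `j` through `σ`, so `ψ` is injective because each relevant `σ` is.
  let τ : Pt → Pt := fun x => match x with
    | top => top
    | lim k n => lim k n
    | pt k e j b => pt k e (σ (inv k) e j) b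
  have hφψ : ∀ x, (φ (ψ x)).1 = τ x.1 := by
    rintro ⟨_ | ⟨k, n⟩ | ⟨k, e, j, b⟩, hx⟩
    · exact hz₀
    · obtain ⟨⟨i, rfl⟩, h1, h2⟩ := hx
      have := hzz i n (by omega) h2
      simpa only [ψ, τ, hinv i] using this
    · obtain ⟨⟨i, rfl⟩, he⟩ := hx
      have := ((hσp i e he).2.2 b j).2
      simpa only [ψ, τ, hinv i] using this
  have hψc : Continuous ψ := by
    refine (isFan (S := range κ)).continuous_iff.2 ?_
    rintro ⟨_ | ⟨k, n⟩ | ⟨k, e, j, b⟩, hv⟩ hx V hV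
    · obtain ⟨m, hm⟩ := hU.mem_iff.1 (show V ∈ 𝓝 z₀ from hV)
      refine ⟨κ m, ?_⟩
      rintro ⟨_ | ⟨k, n⟩ | ⟨k, e, j, b⟩, hw⟩ hy hl
      · exact mem_of_mem_nhds hV
      · cases congrArg Subtype.val hy
      · have hend := node_eq_top_iff.1 (show node k (e + b.toNat) = top from
          congrArg Subtype.val hy)
        have hlk : κ m ≤ k := by
          have : level (pt k e j b) = k := if_pos hend
          exact hl.trans this.le
        obtain ⟨⟨i, rfl⟩, he⟩ := hw
        have h1 := hBend i _ hend _ ((hσp i e he).2.2 b j).1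
        have h2 := hm (hU.antitone (hκ.le_iff_le.1 hlk) h1)
        simpa only [ψ, hinv i] using h2
    · obtain ⟨⟨i, rfl⟩, h1, h2⟩ := hv
      simp only [ψ, hinv i] at hV
      obtain ⟨l, hl⟩ := (hBmid i n h1 h2).1 V hV
      refine ⟨l, ?_⟩
      rintro ⟨_ | ⟨k', n'⟩ | ⟨k', e, j, b⟩, hw⟩ hy hlev
      · cases congrArg Subtype.val hy
      · have h3 : lim k' n' = lim (κ i) n := congrArg Subtype.val hy
        simp only [lim.injEq] at h3
        obtain ⟨rfl, rfl⟩ := h3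
        simpa only [ψ, hinv i] using mem_of_mem_nhds hV
      · obtain ⟨rfl, rfl, h4⟩ := node_eq_lim_iff.1 (show node k' (e + b.toNat) = lim (κ i) n from
          congrArg Subtype.val hy)
        have hlk : l ≤ j := by
          have : level (pt (κ i) e j b) = j := if_neg h4
          exact hlev.trans this.le
        have h5 := hl (hanti i _ hlk ((hσp i e hw.2).2.2 b j).1)
        simpa only [ψ, hinv i] using h5
    · exact absurd (congrArg Subtype.val hx) (node_ne_pt _ _ _ _ _ _)
  have hψi : Function.Injective ψ := by
    intro x y hxy
    have h : τ x.1 = τ y.1 := by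
      rw [← hφψ, ← hφψ]
      exact congrArg (fun z => (φ z).1) hxy
    apply Subtype.ext
    rcases x with ⟨_ | ⟨k, n⟩ | ⟨k, e, j, b⟩, hx⟩ <;>
      rcases y with ⟨_ | ⟨k', n'⟩ | ⟨k', e', j', b'⟩, hy⟩ <;> simp only [τ] at h ⊢ <;>
      first
      | exact h
      | cases h
      | skip
    simp only [pt.injEq] at h
    obtain ⟨rfl, rfl, h, rfl⟩ := h
    obtain ⟨⟨i, rfl⟩, he⟩ := hx
    rw [hinv i] at h
    rw [(hσp i e he).1.injective h]
  refine ⟨range κ, ?_, infinite_range_of_injective hκ.injective, ⟨⟨ψ, ?_⟩, hψc, hψi⟩⟩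
  · rintro _ ⟨i, rfl⟩
    have h := ((hσp i 0 (Nat.zero_le _)).2.2 false 0).2
    have hv := (φ (p i 0 false 0)).2
    rw [h] at hv
    exact hv.1
  · have main : ∀ (i e j : ℕ) (x y : Space (range κ)), x.1 = pt (κ i) e j false →
        y.1 = pt (κ i) e j true → Z.graph.Adj (ψ x) (ψ y) := by
      intro i e j x y hx hy
      have he : e ≤ 2 * κ i + 2 := by
        have := x.2
        rw [hx] at this
        exact this.2
      simpa only [ψ, hx, hy, hinv i] using (hσp i e he).2.1 j
    rintro x y ⟨k, e, j, b, hx, hy⟩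
    have hk : k ∈ range κ := by
      have := x.2
      rw [hx] at this
      exact this.1
    obtain ⟨i, rfl⟩ := hk
    cases b with
    | false => exact main i e j x y hx hy
    | true => exact (main i e j y x hy hx).symm

end Space

/-! ### Rigidity: reductions between models. -/

/-- An injection of `{1, …, m}` into `{1, …, m'}` that moves by steps of `±1` and has both ends
at ends is onto. -/
theorem eq_of_injOn_of_step {m m' : ℕ} {f : ℕ → ℕ} (hm : 2 ≤ m)
    (hf : ∀ n, 1 ≤ n → n ≤ m → 1 ≤ f n ∧ f n ≤ m') (hinj : InjOn f (Icc 1 m))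
    (hstep : ∀ n, 1 ≤ n → n + 1 ≤ m → f (n + 1) = f n + 1 ∨ f n = f (n + 1) + 1)
    (h1 : f 1 = 1 ∨ f 1 = m') (h2 : f m = 1 ∨ f m = m') : m = m' := by
  have hle : m ≤ m' := by
    have : (Finset.Icc 1 m).card ≤ (Finset.Icc 1 m').card := by
      refine Finset.card_le_card_of_injOn f ?_ ?_
      · intro n hn
        simp only [Finset.coe_Icc, mem_Icc] at hn ⊢
        exact hf n hn.1 hn.2
      · simpa using hinj
    simpa using this
  have hne : f 1 ≠ f m := fun h => by
    have := hinj ⟨le_rfl, by omega⟩ ⟨by omega, le_rfl⟩ h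
    omega
  -- `f 1` and `f m` are distinct ends, hence at distance `m' - 1`, while `m - 1` unit steps
  -- separate them; this gives `m' ≤ m`.
  have hdist : ∀ n, 1 ≤ n → n ≤ m → f n + 1 ≤ f 1 + n ∧ f 1 + 1 ≤ f n + n := by
    intro n hn
    induction n, hn using Nat.le_induction with
    | base => intro _; omega
    | succ n hn ih =>
      intro hnm
      have := ih (by omega)
      have := hstep n hn hnm
      omega
  have := hdist m (by omega) le_rfl
  omega

namespace Space

variable {R T : Set ℕ}

/-- Removing one cycle from `R` leaves an infinite set, so `top` is still attained by
`exists_eq_tp`. By injectivity its preimage is always the same point, which therefore lies on no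
single cycle's private part. -/
theorem map_tp (hR : R.Infinite) (f : graph R →g graph T) (hf : Continuous f)
    (hinj : Function.Injective f) : (f (tp R)).1 = top := by
  have key : ∀ R' (h : R' ⊆ R), R'.Infinite → ∃ x, (f (incl h x)).1 = top := fun R' h hR' =>
    exists_eq_tp (Z := model R') (not_contColorable hR') (f.comp (incl h))
      (hf.comp (continuous_incl h)) (hinj.comp (injective_incl h))
  have main : ∀ k, ∃ x : Space R, Valid (R \ {k}) x.1 ∧ (f x).1 = top := by
    intro k
    obtain ⟨x, hx⟩ := key (R \ {k}) sdiff_subset (hR.sdiff (finite_singleton k))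
    exact ⟨_, x.2, hx⟩
  obtain ⟨x, -, hx⟩ := main 0
  have huniq : ∀ y, (f y).1 = top → y = x := fun y hy =>
    hinj (Subtype.ext (hy.trans hx.symm))
  rcases hx1 : x.1 with _ | ⟨k, n⟩ | ⟨k, e, j, b⟩
  · rwa [show tp R = x from Subtype.ext hx1.symm]
  · obtain ⟨y, hy, hy'⟩ := main k
    rw [huniq y hy', hx1] at hy
    exact absurd rfl hy.1.2
  · obtain ⟨y, hy, hy'⟩ := main k
    rw [huniq y hy', hx1] at hy
    exact absurd rfl hy.1.2

/-- A non-isolated inner node is mapped to an inner node, together with a neighborhood. -/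
theorem map_nd (hR : R.Infinite) (f : graph R →g graph T) (hf : Continuous f)
    (hinj : Function.Injective f) {k n : ℕ} (hk : k ∈ R) (h1 : 1 ≤ n) (h2 : n ≤ 2 * k + 2) :
    ∃ k' n', (f (nd hk (h2.trans (Nat.le_succ _)))).1 = lim k' n' ∧
      ∃ J, ∀ (e : ℕ) (he : e ≤ 2 * k + 2) (b : Bool) (j : ℕ), e + b.toNat = n → J ≤ j →
        ∃ e' j' b', (f (mk hk he j b)).1 = pt k' e' j' b' ∧ e' + b'.toNat = n' := by
  have htp := map_tp hR f hf hinj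
  set x := nd hk (h2.trans (Nat.le_succ _)) with hx
  have hxt : x.1 ≠ top := by
    rw [show x.1 = node k n from rfl, node_of_mid h1 h2]
    simp
  have hxmk : ∀ (e : ℕ) (he : e ≤ 2 * k + 2) j b, mk hk he j b ≠ x := fun e he j b h =>
    node_ne_pt _ _ _ _ _ _ (congrArg Subtype.val h).symm
  rcases hfx : (f x).1 with _ | ⟨k', n'⟩ | ⟨k', e', j', b'⟩
  · exact absurd (congrArg Subtype.val (hinj (Subtype.ext (hfx.trans htp.symm)))) hxt
  · refine ⟨k', n', rfl, ?_⟩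
    have hopen : IsOpen (rt ⁻¹' {f x} : Set (Space T)) := isFan.isOpen_root_preimage _
    obtain ⟨J, hJ⟩ := exists_forall_mk_mem hf hk h1 h2
      (hopen.mem_nhds (show rt (f x) = f x from Subtype.ext (by
        change root (f x).1 = (f x).1
        rw [hfx]; rfl)))
    refine ⟨J, fun e he b j hn hj => ?_⟩
    have h3 : root (f (mk hk he j b)).1 = (f x).1 := congrArg Subtype.val (hJ e he b j hn hj)
    rw [hfx] at h3
    rcases hy : (f (mk hk he j b)).1 with _ | ⟨k₁, n₁⟩ | ⟨k₁, e₁, j₁, b₁⟩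
    · rw [hy] at h3; cases h3
    · rw [hy] at h3
      exact absurd (hinj (Subtype.ext (by rw [hy, hfx, ← h3]; rfl))) (hxmk e he j b)
    · rw [hy] at h3
      obtain ⟨rfl, rfl, -⟩ := node_eq_lim_iff.1 h3
      exact ⟨e₁, j₁, b₁, rfl, rfl⟩
  · exfalso
    -- An isolated image would be shared by all nearby points, against injectivity.
    have hiso : rt (f x) ≠ f x := fun h => by
      have := congrArg Subtype.val h
      change root (f x).1 = _ at this
      rw [hfx] at this
      exact node_ne_pt _ _ _ _ _ _ this
    obtain ⟨J, hJ⟩ := exists_forall_mk_mem hf hk h1 h2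
      ((isFan.isOpen_singleton hiso).mem_nhds rfl)
    exact hxmk n h2 J false (hinj (hJ n h2 false J rfl le_rfl))

theorem adj_pt {S : Set ℕ} {x y : Space S} (h : (graph S).Adj x y) {k e j : ℕ} {b : Bool}
    (hx : x.1 = pt k e j b) : y.1 = pt k e j (!b) := by
  obtain ⟨k', e', j', b', h1, h2⟩ := h
  rw [hx] at h1
  simp only [pt.injEq] at h1
  obtain ⟨rfl, rfl, rfl, rfl⟩ := h1
  exact h2

/-- For large `k`, points attached to the ends of the `k`-th cycle go to points attached to `top`.
Edges near the inner nodes show that consecutive inner nodes go to consecutive inner nodes of one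
cycle, and that the extreme ones go next to `top`. Thus the path of inner nodes is mapped onto that
of a cycle of the same length. -/
theorem eventually_mem_of_injLE (hR : R.Infinite) (h : (model R).InjLE (model T)) :
    ∃ K, ∀ k ∈ R, K ≤ k → k ∈ T := by
  obtain ⟨f, hf, hinj⟩ := h
  change graph R →g graph T at f
  have htp := map_tp hR f hf hinj
  have hopen : IsOpen (rt ⁻¹' {tp T} : Set (Space T)) := isFan.isOpen_root_preimage _
  obtain ⟨K, hK⟩ := exists_forall_mk_mem_top hf
    (hopen.mem_nhds (show rt (f (tp R)) = tp T from Subtype.ext (by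
      change root (f (tp R)).1 = top
      rw [htp]; rfl)))
  refine ⟨K, fun k hk hKk => ?_⟩
  have hends : ∀ (e : ℕ) (he : e ≤ 2 * k + 2) (b : Bool) (j : ℕ),
      (e + b.toNat = 0 ∨ e + b.toNat = 2 * k + 3) → ∀ k' e' j' b',
        (f (mk hk he j b)).1 = pt k' e' j' b' →
          e' + b'.toNat = 0 ∨ e' + b'.toNat = 2 * k' + 3 := by
    intro e he b j hn k' e' j' b' hx
    have := congrArg Subtype.val (hK k hk e he b j hn hKk)
    change root (f (mk hk he j b)).1 = top at this
    rw [hx] at this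
    exact node_eq_top_iff.1 this
  have hnode : ∀ n, ∃ k' n', 1 ≤ n → ∀ h2 : n ≤ 2 * k + 2,
      (f (nd hk (h2.trans (Nat.le_succ _)))).1 = lim k' n' ∧
      ∃ J, ∀ (e : ℕ) (he : e ≤ 2 * k + 2) (b : Bool) (j : ℕ), e + b.toNat = n → J ≤ j →
        ∃ e' j' b', (f (mk hk he j b)).1 = pt k' e' j' b' ∧ e' + b'.toNat = n' := by
    intro n
    by_cases h : 1 ≤ n ∧ n ≤ 2 * k + 2
    · obtain ⟨k', n', h'⟩ := map_nd hR f hf hinj hk h.1 h.2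
      exact ⟨k', n', fun _ _ => h'⟩
    · exact ⟨0, 0, fun h1 h2 => absurd ⟨h1, h2⟩ h⟩
  choose κ ν hlim using hnode
  have hstep : ∀ n, 1 ≤ n → n + 1 ≤ 2 * k + 2 → κ (n + 1) = κ n ∧
      (ν (n + 1) = ν n + 1 ∨ ν n = ν (n + 1) + 1) := by
    intro n h1 h2
    obtain ⟨-, J, hJ⟩ := hlim n h1 (by omega)
    obtain ⟨-, J', hJ'⟩ := hlim (n + 1) (by omega) h2
    have he : n ≤ 2 * k + 2 := by omega
    obtain ⟨e₁, j₁, b₁, hx, hn1⟩ := hJ n he false _ rfl (le_max_left J J')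
    obtain ⟨e₂, j₂, b₂, hy, hn2⟩ := hJ' n he true _ rfl (le_max_right J J')
    have := adj_pt (f.map_adj (adj_mk hk he (max J J'))) hx
    rw [hy] at this
    simp only [pt.injEq] at this
    obtain ⟨h3, rfl, -, rfl⟩ := this
    refine ⟨h3, ?_⟩
    cases b₁ <;> simp at hn1 hn2 <;> omega
  have hκ : ∀ n, 1 ≤ n → n ≤ 2 * k + 2 → κ n = κ 1 := by
    intro n hn
    induction n, hn using Nat.le_induction with
    | base => intro _; rfl
    | succ n hn ih => intro h; rw [(hstep n hn h).1, ih (by omega)]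
  have hval : ∀ n, 1 ≤ n → n ≤ 2 * k + 2 → κ n ∈ T ∧ 1 ≤ ν n ∧ ν n ≤ 2 * κ n + 2 := by
    intro n h1 h2
    have hv := (f (nd hk (h2.trans (Nat.le_succ _)))).2
    rw [(hlim n h1 h2).1] at hv
    exact hv
  have hkk : 2 * k + 2 = 2 * κ 1 + 2 := by
    refine eq_of_injOn_of_step (f := ν) (by omega) ?_ ?_ (fun n h1 h2 => (hstep n h1 h2).2) ?_ ?_
    · intro n h1 h2
      have := (hval n h1 h2).2
      rwa [hκ n h1 h2] at this
    · rintro n ⟨hn1, hn2⟩ m ⟨hm1, hm2⟩ hnm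
      have heq : f (nd hk (hn2.trans (Nat.le_succ _))) = f (nd hk (hm2.trans (Nat.le_succ _))) := by
        apply Subtype.ext
        rw [(hlim n hn1 hn2).1, (hlim m hm1 hm2).1, hκ n hn1 hn2, hκ m hm1 hm2, hnm]
      have h3 : node k n = node k m := congrArg Subtype.val (hinj heq)
      rw [node_of_mid hn1 hn2, node_of_mid hm1 hm2] at h3
      simpa using h3
    -- An edge of quasi-edge `0` near node `1` has its other end attached to `top`; the same holds
    -- for its image, so the image of node `1` is the first or last inner node.
    · obtain ⟨-, J, hJ⟩ := hlim 1 le_rfl (by omega)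
      have he : 0 ≤ 2 * k + 2 := by omega
      obtain ⟨e, j, b, hx, hn⟩ := hJ 0 he true J rfl le_rfl
      have hy := adj_pt (f.map_adj (adj_mk hk he J).symm) hx
      have hend := hends 0 he false J (Or.inl rfl) _ _ _ _ hy
      have := (hval 1 le_rfl (by omega)).2
      have hv := (f (mk hk he J false)).2
      rw [hy] at hv
      have := hv.2
      cases b <;> simp at hn hend <;> omega
    · have hlast := hκ (2 * k + 2) (by omega) le_rfl
      obtain ⟨-, J, hJ⟩ := hlim (2 * k + 2) (by omega) le_rfl
      obtain ⟨e, j, b, hx, hn⟩ := hJ (2 * k + 2) le_rfl false J rfl le_rfl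
      have hy := adj_pt (f.map_adj (adj_mk hk le_rfl J)) hx
      have hend := hends (2 * k + 2) le_rfl true J (Or.inr rfl) _ _ _ _ hy
      have := (hval (2 * k + 2) (by omega) le_rfl).2
      have hv := (f (mk hk (le_refl (2 * k + 2)) J true)).2
      rw [hy] at hv
      have := hv.2
      cases b <;> simp at hn hend <;> omega
  have : k = κ 1 := by omega
  exact this ▸ (hval 1 le_rfl (by omega)).1

end Space

/-! ### Decoding the sequences of `ℙ` as points of `model univ`. -/

namespace Gm

open Letter

/-- The letter `a` or `ā`. -/
def dir : Bool → Letter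
  | false => a
  | true => abar

theorem dir_injective : Function.Injective dir := by
  rintro (_ | _) (_ | _) h <;> first | rfl | cases h

theorem dir_ne_c (b : Bool) : dir b ≠ c := by cases b <;> simp [dir]

theorem dir_ne_num (b : Bool) (i : ℕ) : dir b ≠ num i := by cases b <;> simp [dir]

theorem dir_not_ne (b : Bool) : dir (!b) ≠ dir b := by cases b <;> simp [dir]

/-- The sequence `c^{k+1} δ^{j+1} ε^∞`. -/
def endSeq (k j : ℕ) (δ ε : Letter) : Seq := fun t =>
  if t < k + 1 then c else if t < k + j + 2 then δ else ε

/-- The sequence `k i^{j+1} δ^∞`. -/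
def midSeq (k i j : ℕ) (δ : Letter) : Seq := fun t =>
  if t = 0 then num k else if t < j + 2 then num i else δ

theorem wordThen_end (k j : ℕ) (δ ε : Letter) :
    wordThen (List.replicate (k + 1) c ++ List.replicate (j + 1) δ) ε = endSeq k j δ ε := by
  funext t
  by_cases h1 : t < k + 1
  · simp [wordThen, endSeq, h1, List.getD_eq_getElem?_getD, List.getElem?_append]
  · by_cases h2 : t < k + j + 2
    · have h3 : t - (k + 1) < j + 1 := by omega
      simp [wordThen, endSeq, h1, h2, h3, List.getD_eq_getElem?_getD, List.getElem?_append]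
    · have h3 : ¬ t - (k + 1) < j + 1 := by omega
      simp [wordThen, endSeq, h1, h2, h3, List.getD_eq_getElem?_getD, List.getElem?_append]

theorem wordThen_mid (k i j : ℕ) (δ : Letter) :
    wordThen (num k :: List.replicate (j + 1) (num i)) δ = midSeq k i j δ := by
  funext t
  cases t with
  | zero => simp [wordThen, midSeq]
  | succ t =>
    by_cases h : t < j + 1
    · have h' : t + 1 < j + 2 := by omega
      simp [wordThen, midSeq, h', List.getD_eq_getElem?_getD]
    · have h' : ¬ t + 1 < j + 2 := by omega
      simp [wordThen, midSeq, h', List.getD_eq_getElem?_getD]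

theorem wordThen_limit (k : ℕ) (δ : Letter) :
    wordThen (List.replicate (k + 1) c) δ = fun t => if t < k + 1 then c else δ := by
  funext t
  by_cases h : t < k + 1 <;>
    simp [wordThen, h, List.getD_eq_getElem?_getD]

theorem endSeq_zero (k j : ℕ) (δ ε : Letter) : endSeq k j δ ε 0 = c := by simp [endSeq]

theorem endSeq_of_lt {k j t : ℕ} {δ ε : Letter} (h : t < k + 1) : endSeq k j δ ε t = c := by
  simp [endSeq, h]

theorem endSeq_of_mem {k j t : ℕ} {δ ε : Letter} (h : k + 1 ≤ t) (h' : t < k + j + 2) :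
    endSeq k j δ ε t = δ := by
  simp [endSeq, h', not_lt.2 h]

theorem endSeq_of_ge {k j t : ℕ} {δ ε : Letter} (h : k + j + 2 ≤ t) :
    endSeq k j δ ε t = ε := by
  have : ¬ t < k + 1 := by omega
  simp [endSeq, this, not_lt.2 h]

theorem midSeq_zero (k i j : ℕ) (δ : Letter) : midSeq k i j δ 0 = num k := by simp [midSeq]

theorem midSeq_of_mem {k i j t : ℕ} {δ : Letter} (h : 1 ≤ t) (h' : t < j + 2) :
    midSeq k i j δ t = num i := by
  have : t ≠ 0 := by omega
  simp [midSeq, this, h']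

theorem midSeq_of_ge {k i j t : ℕ} {δ : Letter} (h : j + 2 ≤ t) : midSeq k i j δ t = δ := by
  have : t ≠ 0 := by omega
  simp [midSeq, this, not_lt.2 h]

theorem endSeq_eq_of_agree {k j k' j' T : ℕ} {b b' : Bool} (hk : k + 1 < T)
    (h : ∀ t < T, endSeq k' j' (dir b') (dir !b') t = endSeq k j (dir b) (dir !b) t) :
    k' = k ∧ b' = b ∧ (k + j + 2 < T → j' = j) := by
  have hkk : k' = k := by
    rcases lt_trichotomy k' k with hlt | heq | hlt
    · have := h (k' + 1) (by omega)
      rw [endSeq_of_mem le_rfl (by omega), endSeq_of_lt (by omega)] at this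
      exact absurd this (dir_ne_c _)
    · exact heq
    · have := h (k + 1) hk
      rw [endSeq_of_lt (by omega), endSeq_of_mem le_rfl (by omega)] at this
      exact absurd this.symm (dir_ne_c _)
  subst hkk
  have hbb : b' = b := by
    have := h (k' + 1) hk
    rw [endSeq_of_mem le_rfl (by omega), endSeq_of_mem le_rfl (by omega)] at this
    exact dir_injective this
  subst hbb
  refine ⟨rfl, rfl, fun hj => ?_⟩
  rcases lt_trichotomy j' j with hlt | heq | hlt
  · have := h (k' + j' + 2) (by omega)
    rw [endSeq_of_ge le_rfl, endSeq_of_mem (by omega) (by omega)] at this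
    exact absurd this (dir_not_ne _)
  · exact heq
  · have := h (k' + j + 2) hj
    rw [endSeq_of_mem (by omega) (by omega), endSeq_of_ge le_rfl] at this
    exact absurd this.symm (dir_not_ne _)

theorem midSeq_eq_of_agree {k i j k' i' j' : ℕ} {b b' : Bool}
    (h : ∀ t < j + 3, midSeq k' i' j' (dir b') t = midSeq k i j (dir b) t) :
    k' = k ∧ i' = i ∧ j' = j ∧ b' = b := by
  have h0 := h 0 (by omega)
  have h1 := h 1 (by omega)
  rw [midSeq_zero, midSeq_zero, num.injEq] at h0
  rw [midSeq_of_mem le_rfl (by omega), midSeq_of_mem le_rfl (by omega), num.injEq] at h1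
  have hj : j' = j := by
    rcases lt_trichotomy j' j with hlt | heq | hlt
    · have := h (j' + 2) (by omega)
      rw [midSeq_of_ge le_rfl, midSeq_of_mem (by omega) (by omega)] at this
      exact absurd this (dir_ne_num _ _)
    · exact heq
    · have := h (j + 2) (by omega)
      rw [midSeq_of_mem (by omega) (by omega), midSeq_of_ge le_rfl] at this
      exact absurd this.symm (dir_ne_num _ _)
  subst hj
  have h2 := h (j' + 2) (by omega)
  rw [midSeq_of_ge le_rfl, midSeq_of_ge le_rfl] at h2
  exact ⟨h0, h1, rfl, dir_injective h2⟩

/-- The sequence coded by a point of the model. -/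
def emb : Pt → Seq
  | top => fun _ => c
  -- Inner nodes are numbered from `1` but the letters `i` start at `0`, hence the shift.
  | lim k n => fun t => if t = 0 then num k else num (n - 1)
  | pt k e j b => if e + b.toNat = 0 ∨ e + b.toNat = 2 * k + 3 then endSeq k j (dir b) (dir !b)
      else midSeq k (e + b.toNat - 1) j (dir b)

theorem emb_pt_of_end {k e j : ℕ} {b : Bool} (h : e + b.toNat = 0 ∨ e + b.toNat = 2 * k + 3) :
    emb (pt k e j b) = endSeq k j (dir b) (dir !b) := if_pos h

theorem emb_pt_of_mid {k e j : ℕ} {b : Bool}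
    (h : ¬ (e + b.toNat = 0 ∨ e + b.toNat = 2 * k + 3)) :
    emb (pt k e j b) = midSeq k (e + b.toNat - 1) j (dir b) := if_neg h

/-- A length of initial segment that determines an isolated point. -/
def radius : Pt → ℕ
  -- The segment just reaches the first letter after the block of length `j + 1`, which reveals `j`.
  | pt k e j b => if e + b.toNat = 0 ∨ e + b.toNat = 2 * k + 3 then k + j + 3 else j + 3
  | _ => 0

theorem eq_of_agree {S : Set ℕ} {w : Pt} {k e j : ℕ} {b : Bool} (hw : Valid S w)
    (he : e ≤ 2 * k + 2) (h : ∀ t < radius (pt k e j b), emb w t = emb (pt k e j b) t) :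
    w = pt k e j b := by
  by_cases hend : e + b.toNat = 0 ∨ e + b.toNat = 2 * k + 3
  · rw [emb_pt_of_end hend, show radius (pt k e j b) = k + j + 3 from if_pos hend] at h
    have h0 := h 0 (by omega)
    rw [endSeq_zero] at h0
    rcases w with _ | ⟨k', n'⟩ | ⟨k', e', j', b'⟩
    · have := h (k + 1) (by omega)
      rw [endSeq_of_mem le_rfl (by omega)] at this
      exact absurd this.symm (dir_ne_c _)
    · simp [emb] at h0
    · by_cases hend' : e' + b'.toNat = 0 ∨ e' + b'.toNat = 2 * k' + 3
      · rw [emb_pt_of_end hend'] at h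
        obtain ⟨rfl, rfl, hj⟩ := endSeq_eq_of_agree (by omega) h
        have he' := hw.2
        rw [hj (by omega)]
        cases b' <;> simp only [Bool.toNat_true, Bool.toNat_false] at hend hend' <;>
          congr 1 <;> omega
      · rw [emb_pt_of_mid hend', midSeq_zero] at h0
        cases h0
  · rw [emb_pt_of_mid hend, show radius (pt k e j b) = j + 3 from if_neg hend] at h
    have h0 := h 0 (by omega)
    rw [midSeq_zero] at h0
    rcases w with _ | ⟨k', n'⟩ | ⟨k', e', j', b'⟩
    · cases h0
    · have := h (j + 2) (by omega)
      rw [midSeq_of_ge le_rfl] at this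
      simp only [emb] at this
      rw [if_neg (by omega)] at this
      exact absurd this.symm (dir_ne_num _ _)
    · by_cases hend' : e' + b'.toNat = 0 ∨ e' + b'.toNat = 2 * k' + 3
      · rw [emb_pt_of_end hend', endSeq_zero] at h0
        cases h0
      · rw [emb_pt_of_mid hend'] at h
        obtain ⟨rfl, hi, rfl, rfl⟩ := midSeq_eq_of_agree h
        congr 1
        omega

/-- The inverse of `emb` is continuous. -/
theorem exists_forall_agree {S : Set ℕ} (x : Space S) {U : Set (Space S)} (hU : IsOpen U)
    (hx : x ∈ U) : ∃ n, ∀ y : Space S, (∀ t < n, emb y.1 t = emb x.1 t) → y ∈ U := by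
  obtain ⟨x, hv⟩ := x
  rcases x with _ | ⟨k, n⟩ | ⟨k, e, j, b⟩
  · obtain ⟨K, hK⟩ := (Space.isFan.isOpen_iff U).1 hU _ hx rfl
    refine ⟨K + 2, ?_⟩
    rintro ⟨y, hy⟩ h
    have h0 : emb y 0 = c := h 0 (by omega)
    rcases y with _ | ⟨k', n'⟩ | ⟨k', e', j', b'⟩
    · exact hx
    · simp [emb] at h0
    · by_cases hend : e' + b'.toNat = 0 ∨ e' + b'.toNat = 2 * k' + 3
      · refine hK _ (Subtype.ext (node_of_end hend)) ?_
        have hl : level (pt k' e' j' b') = k' := if_pos hend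
        refine le_of_le_of_eq ?_ hl.symm
        by_contra hlt
        have h1 : emb (pt k' e' j' b') (k' + 1) = c := h (k' + 1) (by omega)
        rw [emb_pt_of_end hend, endSeq_of_mem le_rfl (by omega)] at h1
        exact dir_ne_c _ h1
      · rw [emb_pt_of_mid hend, midSeq_zero] at h0
        cases h0
  · obtain ⟨J, hJ⟩ := (Space.isFan.isOpen_iff U).1 hU _ hx rfl
    refine ⟨J + 3, ?_⟩
    rintro ⟨y, hy⟩ h
    have h0 : emb y 0 = num k := h 0 (by omega)
    have hs : ∀ t, 1 ≤ t → t < J + 3 → emb y t = num (n - 1) := by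
      intro t h1 h2
      refine (h t h2).trans ?_
      simp only [emb]
      rw [if_neg (by omega)]
    have h1 := hs 1 le_rfl (by omega)
    rcases y with _ | ⟨k', n'⟩ | ⟨k', e', j', b'⟩
    · cases h0
    · have h2 := hv.2.1
      have h3 := hy.2.1
      simp only [emb, if_true, num.injEq, one_ne_zero, if_false] at h0 h1
      have h4 : n' = n := by omega
      subst h0 h4
      exact hx
    · by_cases hend : e' + b'.toNat = 0 ∨ e' + b'.toNat = 2 * k' + 3
      · rw [emb_pt_of_end hend, endSeq_zero] at h0
        cases h0
      · have hl : level (pt k' e' j' b') = j' := if_neg hend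
        rw [emb_pt_of_mid hend, midSeq_zero, num.injEq] at h0
        rw [emb_pt_of_mid hend, midSeq_of_mem le_rfl (by omega), num.injEq] at h1
        have h2 := hv.2.1
        have h4 : e' + b'.toNat = n := by omega
        subst h0
        refine hJ _ (Subtype.ext ?_) ?_
        · change node k' (e' + b'.toNat) = lim k' n
          rw [h4]
          exact node_of_mid hv.2.1 hv.2.2
        · refine le_of_le_of_eq ?_ hl.symm
          by_contra hlt
          have h5 := hs (j' + 2) (by omega) (by omega)
          rw [emb_pt_of_mid hend, midSeq_of_ge le_rfl] at h5
          exact dir_ne_num _ _ h5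
  · refine ⟨radius (pt k e j b), fun y hy => ?_⟩
    have : y = ⟨pt k e j b, hv⟩ := Subtype.ext (eq_of_agree y.2 hv.2 hy)
    rwa [this]

theorem emb_injective {S : Set ℕ} : Function.Injective fun x : Space S => emb x.1 := by
  intro x y hxy
  by_contra hne
  obtain ⟨n, hn⟩ := exists_forall_agree x
    (Space.isFan.isClosed_singleton y).isOpen_compl hne
  exact hn y (fun t _ => (congrFun hxy t).symm) rfl

theorem Om.exists_emb {x y : Seq} (h : Om x y) :
    ∃ k e j, e ≤ 2 * k + 2 ∧ emb (pt k e j false) = x ∧ emb (pt k e j true) = y := by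
  cases h with
  | first j k =>
    refine ⟨k, 0, j, by omega, ?_, ?_⟩
    · rw [wordThen_end, emb_pt_of_end (by simp)]; rfl
    · rw [wordThen_mid, emb_pt_of_mid (by simp)]; rfl
  | middle j k i hi =>
    refine ⟨k, i + 1, j, by omega, ?_, ?_⟩
    · rw [wordThen_mid, emb_pt_of_mid (by simp; omega)]; rfl
    · rw [wordThen_mid, emb_pt_of_mid (by simp; omega)]; rfl
  | last j k =>
    refine ⟨k, 2 * k + 2, j, by omega, ?_, ?_⟩
    · rw [wordThen_mid, emb_pt_of_mid (by simp)]; rfl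
    · rw [wordThen_end, emb_pt_of_end (by simp)]; rfl

theorem exists_emb_of_mem_support {x : Seq} (h : x ∈ graphN.support) :
    ∃ k e j b, e ≤ 2 * k + 2 ∧ emb (pt k e j b) = x := by
  obtain ⟨y, h | h⟩ := h
  · obtain ⟨k, e, j, he, h1, -⟩ := h.exists_emb
    exact ⟨k, e, j, false, he, h1⟩
  · obtain ⟨k, e, j, he, -, h1⟩ := h.exists_emb
    exact ⟨k, e, j, true, he, h1⟩

/-- Either some initial segment of `x` determines an isolated point, or `x` is a limit of points of
unbounded radius. In the latter case `x` is `c^∞`, some `k i^∞`, or some `c^{k+1} ε^∞`, and the last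
kind is excluded from `ℙ`. -/
theorem exists_emb_of_mem_setP {x : Seq} (hx : x ∈ setP) :
    ∃ y : Space univ, emb y.1 = x := by
  have happ : ∀ n, ∃ k e j b, e ≤ 2 * k + 2 ∧ ∀ t < n, emb (pt k e j b) t = x t := by
    intro n
    have hU : IsOpen (⋂ m ∈ Finset.range n, {z : Seq | z m = x m}) :=
      isOpen_biInter_finset fun m _ => (isOpen_discrete ({x m} : Set Letter)).preimage
        (continuous_apply (A := fun _ : ℕ => Letter) m)
    obtain ⟨z, hz, hzs⟩ := mem_closure_iff.1 hx.1 _ hU (by simp)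
    obtain ⟨k, e, j, b, he, rfl⟩ := exists_emb_of_mem_support hzs
    refine ⟨k, e, j, b, he, fun t ht => ?_⟩
    simp only [Finset.mem_range, mem_iInter, mem_ofPred_eq] at hz
    exact hz t ht
  by_cases hiso : ∃ n k e j b, e ≤ 2 * k + 2 ∧ radius (pt k e j b) ≤ n ∧
      ∀ t < n, emb (pt k e j b) t = x t
  · obtain ⟨n, k, e, j, b, he, hr, h⟩ := hiso
    refine ⟨⟨pt k e j b, mem_univ _, he⟩, funext fun t => ?_⟩
    obtain ⟨k', e', j', b', he', h'⟩ := happ (max n (t + 1))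
    have : pt k' e' j' b' = pt k e j b := by
      refine eq_of_agree (S := univ) ⟨mem_univ _, he'⟩ he fun s hs => ?_
      rw [h s (by omega), h' s (by omega)]
    change emb (pt k e j b) t = x t
    rw [← this]
    exact h' t (by omega)
  · push Not at hiso
    replace happ : ∀ n, ∃ k e j b, e ≤ 2 * k + 2 ∧ n < radius (pt k e j b) ∧
        ∀ t < n, emb (pt k e j b) t = x t := by
      intro n
      obtain ⟨k, e, j, b, he, h⟩ := happ n
      refine ⟨k, e, j, b, he, ?_, h⟩
      by_contra hlt
      obtain ⟨t, ht, hne⟩ := hiso n k e j b he (not_lt.1 hlt)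
      exact hne (h t ht)
    obtain ⟨k, e, j, b, he, hr, h⟩ := happ 2
    have h0 := h 0 (by omega)
    by_cases hend : e + b.toNat = 0 ∨ e + b.toNat = 2 * k + 3
    · rw [emb_pt_of_end hend, endSeq_zero] at h0
      by_cases hc : ∀ t, x t = c
      · exact ⟨Space.tp univ, (funext hc).symm⟩
      exfalso
      push Not at hc
      obtain ⟨t₀, ht₀⟩ := hc
      -- A letter other than `c` at `t₀` bounds `k`, so the unbounded radius comes from `j` and the
      -- limit is an excluded point.
      have happ' : ∀ n, t₀ < n → ∃ k j b, k + 1 ≤ t₀ ∧ n < k + j + 3 ∧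
          ∀ t < n, endSeq k j (dir b) (dir !b) t = x t := by
        intro n hn
        obtain ⟨k, e, j, b, he, hr, h⟩ := happ n
        by_cases hend : e + b.toNat = 0 ∨ e + b.toNat = 2 * k + 3
        · rw [show radius (pt k e j b) = k + j + 3 from if_pos hend] at hr
          rw [emb_pt_of_end hend] at h
          refine ⟨k, j, b, ?_, hr, h⟩
          by_contra hlt
          have := h t₀ hn
          rw [endSeq_of_lt (by omega)] at this
          exact ht₀ this.symm
        · have := h 0 (by omega)
          rw [emb_pt_of_mid hend, midSeq_zero, ← h0] at this
          cases this
      obtain ⟨k, j, b, hk, -, h⟩ := happ' (t₀ + 1) (Nat.lt_succ_self _)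
      refine hx.2 ⟨k, dir b, by cases b <;> simp [dir], ?_⟩
      rw [wordThen_limit]
      funext t
      obtain ⟨k', j', b', hk', hr', h'⟩ := happ' (max t₀ t + 2) (by omega)
      obtain ⟨rfl, rfl, -⟩ := endSeq_eq_of_agree (T := t₀ + 1) (k := k) (k' := k') (j := j)
        (j' := j') (b := b) (b' := b') (by omega) fun s hs => by
          rw [h s hs, h' s (by omega)]
      rw [← h' t (by omega)]
      by_cases ht : t < k' + 1
      · rw [endSeq_of_lt ht, if_pos ht]
      · rw [endSeq_of_mem (by omega) (by omega), if_neg ht]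
    · have h1 := h 1 (by omega)
      rw [emb_pt_of_mid hend, midSeq_zero] at h0
      rw [emb_pt_of_mid hend, midSeq_of_mem le_rfl (by omega)] at h1
      have hb := b.toNat_le
      refine ⟨⟨lim k (e + b.toNat), mem_univ _, by omega, by omega⟩, funext fun t => ?_⟩
      simp only [emb]
      split_ifs with ht
      · rw [ht, h0]
      · obtain ⟨k', e', j', b', he', hr', h'⟩ := happ (t + 2)
        by_cases hend' : e' + b'.toNat = 0 ∨ e' + b'.toNat = 2 * k' + 3
        · have := h' 0 (by omega)
          rw [emb_pt_of_end hend', endSeq_zero, ← h0] at this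
          cases this
        · rw [show radius (pt k' e' j' b') = j' + 3 from if_neg hend'] at hr'
          have h2 := h' 1 (by omega)
          have h3 := h' t (by omega)
          rw [emb_pt_of_mid hend', midSeq_of_mem (by omega) (by omega)] at h2 h3
          exact h1.trans (h2.symm.trans h3)

theorem graphP_injLE : graphP.InjLE (Space.model univ) := by
  choose F hF using fun x : setP => exists_emb_of_mem_setP x.2
  have hadj : ∀ x y : setP, Om x y → (Space.graph univ).Adj (F x) (F y) := by
    intro x y h
    obtain ⟨k, e, j, he, h1, h2⟩ := h.exists_emb
    have e1 : F x = Space.mk (mem_univ k) he j false := emb_injective ((hF x).trans h1.symm)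
    have e2 : F y = Space.mk (mem_univ k) he j true := emb_injective ((hF y).trans h2.symm)
    rw [e1, e2]
    exact Space.adj_mk _ _ _
  refine ⟨⟨F, ?_⟩, ?_, ?_⟩
  · rintro x y (h | h)
    · exact hadj x y h
    · exact (hadj y x h).symm
  · change Continuous F
    refine continuous_def.2 fun U hU => isOpen_iff_mem_nhds.2 fun x hx => ?_
    obtain ⟨n, hn⟩ := exists_forall_agree (F x) hU hx
    have hO : IsOpen (⋂ m ∈ Finset.range n, {z : setP | z.1 m = x.1 m}) :=
      isOpen_biInter_finset fun m _ => (isOpen_discrete ({x.1 m} : Set Letter)).preimage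
        ((continuous_apply (A := fun _ : ℕ => Letter) m).comp continuous_subtype_val)
    filter_upwards [hO.mem_nhds (by simp)] with z hz
    refine hn _ fun t ht => ?_
    simp only [Finset.mem_range, mem_iInter, mem_ofPred_eq] at hz
    rw [hF, hF]
    exact hz t ht
  · intro x y hxy
    apply Subtype.ext
    rw [← hF x, ← hF y]
    exact congrArg (fun z : Space univ => emb z.1) hxy

end Gm

/-! ### Transfer of the models to an arbitrary universe. -/

namespace TopGraph

/-- A graph moved to a higher universe. -/
def up (G : TopGraph.{0}) : TopGraph.{u} where
  carrier := ULift.{u} G.carrier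
  graph := G.graph.comap ULift.down

theorem up_injLE (G : TopGraph.{0}) : (up.{u} G).InjLE G :=
  ⟨⟨ULift.down, fun h => h⟩, continuous_uliftDown, ULift.down_injective⟩

theorem injLE_up (G : TopGraph.{0}) : G.InjLE (up.{u} G) :=
  ⟨⟨ULift.up, fun h => h⟩, continuous_uliftUp, ULift.up_injective⟩

theorem ccn_eq_of_injLE {G : TopGraph.{u}} {H : TopGraph.{v}} (h : G.InjLE H) (h' : H.InjLE G) :
    G.ccn = H.ccn := by
  have : G.contColorCards = H.contColorCards := by
    ext κ
    exact and_congr_right fun _ => exists_congr fun α => and_congr_right fun _ =>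
      ⟨h'.contColorable, h.contColorable⟩
  unfold ccn
  rw [this]

theorem Is0DP.up {G : TopGraph.{0}} (h : G.Is0DP) : (up.{u} G).Is0DP := by
  obtain ⟨hz, hp⟩ := h
  refine ⟨?_, Homeomorph.ulift.isClosedEmbedding.polishSpace⟩
  refine isTopologicalBasis_of_isOpen_of_nhds (fun s hs => hs.isOpen) fun x U hx hU => ?_
  obtain ⟨V, hV, hxV, hVU⟩ := hz.exists_subset_of_mem_open (a := x.down) (u := ULift.up ⁻¹' U)
    hx (hU.preimage continuous_uliftUp)
  exact ⟨ULift.down ⁻¹' V, hV.preimage continuous_uliftDown, hxV, fun y hy => hVU hy⟩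

theorem Is0DP.is0DMS {G : TopGraph.{u}} (h : G.Is0DP) : G.Is0DMS := by
  obtain ⟨hz, hp⟩ := h
  exact ⟨hz, inferInstance, inferInstance⟩

theorem class0DP_subset : class0DP.{u} ⊆ class0DMS.{u} := fun _ h => ⟨h.1.is0DMS, h.2⟩

end TopGraph

/-! ### Almost disjoint families and the conclusion. -/

/-- Almost disjoint families of size continuum. -/
theorem exists_almost_disjoint {R : Set ℕ} (hR : R.Infinite) :
    ∃ A : (ℕ → Bool) → Set ℕ, (∀ α, (A α).Infinite ∧ A α ⊆ R) ∧
      ∀ α β, α ≠ β → (A α ∩ A β).Finite := by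
  -- Branches of the binary tree, with nodes coded in `R`: distinct branches share only the prefixes
  -- up to their first difference.
  let code : (ℕ → Bool) → ℕ → ℕ := fun α n =>
    hR.natEmbedding R (Encodable.encode ((List.range n).map α))
  have hcode : ∀ α β n m, code α n = code β m → (List.range n).map α = (List.range m).map β :=
    fun α β n m h =>
      Encodable.encode_injective ((hR.natEmbedding R).injective (Subtype.ext h))
  have hlen : ∀ α β n m, code α n = code β m → n = m := fun α β n m h => by
    simpa using congrArg List.length (hcode α β n m h)
  refine ⟨fun α => range (code α), fun α => ⟨?_, ?_⟩, fun α β hne => ?_⟩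
  · exact infinite_range_of_injective fun n m h => hlen α α n m h
  · rintro _ ⟨n, rfl⟩
    exact Subtype.coe_prop _
  · obtain ⟨i, hi⟩ := Function.ne_iff.1 hne
    refine ((finite_Iic i).image (code α)).subset ?_
    rintro _ ⟨⟨n, rfl⟩, m, hm⟩
    refine ⟨n, ?_, rfl⟩
    by_contra hlt
    have hnm := hlen _ _ _ _ hm
    subst hnm
    have h := hcode _ _ _ _ hm
    exact hi (List.map_inj_left.1 h i (List.mem_range.2 (not_le.1 hlt))).symm

namespace Space

theorem exists_family {Z : TopGraph.{u}} (hZ : Z.Is0DMS) (hc : 3 ≤ Z.ccn)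
    (h : Z.InjLE (model univ)) :
    ∃ P : (ℕ → Bool) → TopGraph.{u},
      (∀ α, (P α).Is0DP ∧ (P α).ccn = 3 ∧ (P α).InjLE Z) ∧
      ∀ α β, α ≠ β → TopGraph.Incompatible TopGraph.class0DMS.{u} (P α) (P β) := by
  have hfc : ∀ K : TopGraph.{u}, K.Is0DMS → FirstCountableTopology K.carrier := by
    rintro K ⟨-, hm, -⟩
    infer_instance
  have := hfc Z hZ
  obtain ⟨R, -, hR, hRZ⟩ := exists_model_injLE (TopGraph.three_le_ccn_iff.1 hc) h
  obtain ⟨A, hA, hAA⟩ := exists_almost_disjoint hR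
  refine ⟨fun α => (model (A α)).up, fun α => ⟨(is0DP _).up, ?_, ?_⟩, ?_⟩
  · rw [TopGraph.ccn_eq_of_injLE (model (A α)).up_injLE (model (A α)).injLE_up,
      ccn_eq_three (hA α).1]
  · exact ((model (A α)).up_injLE.trans (injLE_of_subset (hA α).2)).trans hRZ
  · rintro α β hne ⟨K, ⟨hK, hKc⟩, h1, h2⟩
    have := hfc K hK
    obtain ⟨Q, hQA, hQ, hQK⟩ := exists_model_injLE (TopGraph.three_le_ccn_iff.1 hKc)
      (h1.trans (TopGraph.up_injLE _))
    obtain ⟨k₀, hk₀⟩ := eventually_mem_of_injLE hQ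
      ((hQK.trans h2).trans (TopGraph.up_injLE _))
    refine hQ (((finite_Iio k₀).union (hAA α β hne)).subset fun k hk => ?_)
    rcases lt_or_ge k k₀ with hlt | hge
    · exact Or.inl hlt
    · exact Or.inr ⟨hQA hk, hk₀ k hk hge⟩

theorem up_model_mem {S : Set ℕ} (hS : S.Infinite) : (model S).up ∈ TopGraph.class0DP.{u} :=
  ⟨(is0DP S).up, by
    rw [TopGraph.ccn_eq_of_injLE (model S).up_injLE (model S).injLE_up, ccn_eq_three hS]⟩

/-- Any class between the Polish and the separable metrizable one has a continuum-sized pairwise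
incompatible family below any of its elements that lies below `model univ`. -/
theorem exists_family_in {Γ : Set TopGraph.{u}} (h1 : TopGraph.class0DP ⊆ Γ)
    (h2 : Γ ⊆ TopGraph.class0DMS) {Z : TopGraph.{u}} (hZ : Z ∈ Γ) (h : Z.InjLE (model univ)) :
    ∃ P : (ℕ → Bool) → TopGraph.{u}, (∀ α, P α ∈ Γ ∧ (P α).InjLE Z) ∧
      ∀ α β, α ≠ β → TopGraph.Incompatible TopGraph.class0DMS.{u} (P α) (P β) := by
  obtain ⟨P, hP, hinc⟩ := exists_family (h2 hZ).1 (h2 hZ).2 h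
  exact ⟨P, fun α => ⟨h1 ⟨(hP α).1, (hP α).2.1.ge⟩, (hP α).2.2⟩, hinc⟩

/-- For a basis element `H` below `model univ`, any basis element below a member of the family under
`H` is below `H`, hence equal to `H` in an antichain. Then `H` is below two incompatible graphs. -/
theorem not_isAntichainBasisFor {Γ : Set TopGraph.{u}} (h1 : TopGraph.class0DP ⊆ Γ)
    (h2 : Γ ⊆ TopGraph.class0DMS) (B : Set TopGraph.{u}) :
    ¬ TopGraph.IsAntichainBasisFor Γ B := by
  rintro ⟨⟨hBΓ, hB⟩, hanti⟩
  obtain ⟨H, hHB, hH⟩ := hB _ (h1 (up_model_mem infinite_univ))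
  obtain ⟨P, hP, hinc⟩ := exists_family_in h1 h2 (hBΓ hHB) (hH.trans (TopGraph.up_injLE _))
  have hHP : ∀ α, H.InjLE (P α) := by
    intro α
    obtain ⟨H', hH'B, hH'⟩ := hB _ (hP α).1
    have : H' = H := hanti.eq hH'B hHB (hH'.trans (hP α).2)
    exact this ▸ hH'
  refine hinc (fun _ => true) (fun _ => false) (fun h => ?_)
    ⟨H, h2 (hBΓ hHB), hHP _, hHP _⟩
  simpa using congrFun h 0

/-- Basis elements below distinct members of an incompatible family are distinct. -/
theorem continuum_le_mk {Γ : Set TopGraph.{u}} (h1 : TopGraph.class0DP ⊆ Γ)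
    (h2 : Γ ⊆ TopGraph.class0DMS) (B : Set TopGraph.{u}) (hB : TopGraph.IsBasisFor Γ B) :
    𝔠 ≤ #B := by
  obtain ⟨P, hP, hinc⟩ := exists_family_in h1 h2 (h1 (up_model_mem infinite_univ))
    (TopGraph.up_injLE _)
  choose H hHB hH using fun α => hB.2 _ (hP α).1
  have hinj : Function.Injective fun α => (⟨H α, hHB α⟩ : B) := by
    intro α β hαβ
    by_contra hne
    have h3 : H α = H β := congrArg Subtype.val hαβ
    exact hinc α β hne ⟨H α, h2 (hB.1 (hHB α)), hH α, h3 ▸ hH β⟩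
  simpa using lift_mk_le_lift_mk_of_injective hinj

end Space

theorem theorem1p8 :
    (∀ Z : TopGraph.{u}, Z.Is0DMS → 3 ≤ Z.ccn → Z.InjLE Gm.graphP →
      ∃ P : (ℕ → Bool) → TopGraph.{u},
        (∀ α, (P α).Is0DP ∧ (P α).ccn = 3 ∧ (P α).InjLE Z) ∧
        ∀ α β, α ≠ β → TopGraph.Incompatible TopGraph.class0DMS.{u} (P α) (P β)) ∧
    (¬ ∃ B : Set TopGraph.{u}, TopGraph.IsAntichainBasisFor TopGraph.class0DMS.{u} B) ∧
    (¬ ∃ B : Set TopGraph.{u}, TopGraph.IsAntichainBasisFor TopGraph.class0DP.{u} B) ∧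
    (∀ B : Set TopGraph.{u}, TopGraph.IsBasisFor TopGraph.class0DMS.{u} B → 𝔠 ≤ #B) ∧
    (∀ B : Set TopGraph.{u}, TopGraph.IsBasisFor TopGraph.class0DP.{u} B → 𝔠 ≤ #B) :=
  ⟨fun _ hZ hc h => Space.exists_family hZ hc (h.trans Gm.graphP_injLE),
    fun ⟨B, hB⟩ => Space.not_isAntichainBasisFor TopGraph.class0DP_subset subset_rfl B hB,
    fun ⟨B, hB⟩ => Space.not_isAntichainBasisFor subset_rfl TopGraph.class0DP_subset B hB,
    Space.continuum_le_mk TopGraph.class0DP_subset subset_rfl,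
    Space.continuum_le_mk subset_rfl TopGraph.class0DP_subset⟩
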